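/- Let $n,m\ge 1$. Let $g_0=\sum_i\varepsilon_i\,dx_i^2$, $\varepsilon_i\in\{1,-1\}$, be a semi-Euclidean metric on $\mathbb R^n$, let $\alpha=(\alpha_1,\dots,\alpha_n)\neq 0$ and put $\xi(x)=\sum_i\alpha_ix_i$ and $\|\alpha\|^2=\sum_i\varepsilon_i\alpha_i^2$. Let $(F^m,g_F)$ be a non-empty $m$-dimensional semi-Riemannian manifold, let $\varphi,f,h,u:\mathbb R\to\mathbb R$ be smooth with $\varphi$ nowhere zero and $f>0$, and let $\lambda\in\mathbb R$ and $\theta\ge 0$. Regard $\varphi\circ\xi$, $f\circ\xi$, $h\circ\xi$, $u\circ\xi$ as functions on $\mathbb R^n$ and, through the projection $\pi:\mathbb R^n\times F\to\mathbb R^n$, on $M=\mathbb R^n\times F$, and give $M$ the warped product metric $$g=(\varphi\circ\xi)^{-2}g_0+(f\circ\xi)^2g_F .$$ Recall that $(M,g)$ with $U=u\circ\xi\circ\pi$, $h\circ\xi\circ\pi$, $\theta$ and $\lambda$ is a gradient Ricci-harmonic soliton (GRHS) if $$\mathrm{Ric}_g+\mathrm{Hess}_g(h\circ\xi\circ\pi)-\theta\,dU\otimes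 dU=\lambda g,\qquad \tau_gU-g(\nabla U,\nabla (h\circ\xi\circ\pi))=0,$$ where $\tau_gU=\mathrm{trace}_g(\nabla dU)$. Consider the two statements: (A) $M$ is a GRHS with these data and $U$ is non-constant. (B) $u$ is non-constant and there is a constant $\mu\in\mathbb R$ such that $\mathrm{Ric}_{g_F}=\mu g_F$ and the following equations hold on all of $\mathbb R$: $$(n-2)\frac{\varphi''}{\varphi}-m\frac{f''}{f}-2m\frac{\varphi'}{\varphi}\frac{f'}{f}+h''+2\frac{\varphi'}{\varphi}h'-\theta(u')^2=0,$$ $$\left[\frac{\varphi''}{\varphi}-(n-1)\left(\frac{\varphi'}{\varphi}\right)^2+m\frac{\varphi'}{\varphi}\frac{f'}{f}-\frac{\varphi'}{\varphi}h'\right]\|\alpha\|^2=\frac{\lambda}{\varphi^2},$$ $$\left[\frac{f''}{f}-(n-2)\frac{\varphi'}{\varphi}\frac{f'}{f}+(m-1)\left(\frac{f'}{f}\right)^2-\frac{f'}{f}h'\right]\|\alpha\|^2=\frac{\mu}{f^2\varphi^2}-\frac{\lambda}{\varphi^2},$$ $$\left[u''-(n-2)\frac{\varphi'}{\varphi}u'+mu'\frac{f'}{f}-u'h'\right]\|\alpha\|^2=0.$$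 If $n\ge 2$, then (A) holds if and only if (B) holds. For every $n\ge 1$, (B) implies (A). -/

import Mathlib

open scoped Manifold ContDiff

set_option maxSynthPendingDepth 3

noncomputable section

namespace GRHS

section General

variable {E : Type*} [NormedAddCommGroup E] [NormedSpace ℝ E]
  {H : Type*} [TopologicalSpace H] {I : ModelWithCorners ℝ E H}
  {M : Type*} [TopologicalSpace M] [ChartedSpace H M]
  {E' : Type*} [NormedAddCommGroup E'] [NormedSpace ℝ E']
  {H' : Type*} [TopologicalSpace H'] {I' : ModelWithCorners ℝ E' H'}
  {M' : Type*} [TopologicalSpace M'] [ChartedSpace H' M']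

/-- A field of bilinear forms on the tangent spaces of `M`. -/
abbrev BilinField (I : ModelWithCorners ℝ E H) (M : Type*) [TopologicalSpace M]
    [ChartedSpace H M] : Type _ :=
  (p : M) → TangentSpace I p →L[ℝ] TangentSpace I p →L[ℝ] ℝ

/-- The bilinear form `(v, w) ↦ b (A v, A w)`. -/
def pullbackForm (b : E →L[ℝ] E →L[ℝ] ℝ) (A : E' →L[ℝ] E) : E' →L[ℝ] E' →L[ℝ] ℝ :=
  b.bilinearComp A A

/-- The pullback `ψ^* g`: `(ψ^* g)_p (v, w) = g_{ψ p} (dψ_p v, dψ_p w)`. -/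
def pullback (ψ : M' → M) (g : BilinField I M) : BilinField I' M' := fun p =>
  pullbackForm (E := E) (E' := E') (g (ψ p)) (mfderiv I' I ψ p)

theorem pullback_apply (ψ : M' → M) (g : BilinField I M) (p : M') (v w : TangentSpace I' p) :
    pullback (I' := I') ψ g p v w = g (ψ p) (mfderiv I' I ψ p v) (mfderiv I' I ψ p w) := rfl

/-- The expression of `g` in the chart around `p`, a field of bilinear forms on the model vector
space `E` (meaningful on the target of the chart). -/
def inChart (g : BilinField I M) (p : M) : E → E →L[ℝ] E →L[ℝ] ℝ :=
  pullback (I := I) (I' := 𝓘(ℝ, E)) (extChartAt I p).symm g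

theorem inChart_apply (g : BilinField I M) (p : M) (y v w : E) :
    inChart g p y v w = g ((extChartAt I p).symm y)
      (mfderiv 𝓘(ℝ, E) I (extChartAt I p).symm y v)
      (mfderiv 𝓘(ℝ, E) I (extChartAt I p).symm y w) := rfl

/-- `g` is a semi-Riemannian metric on the boundaryless manifold `M`: a smooth field of
symmetric nondegenerate bilinear forms. Smoothness means that its coordinate expressions are
smooth. -/
structure IsSemiRiemannian (g : BilinField I M) : Prop where
  symm : ∀ (p : M) (v w : TangentSpace I p), g p v w = g p w v
  nondegenerate : ∀ (p : M) (v : TangentSpace I p), (∀ w, g p v w = 0) → v = 0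
  smooth : ∀ p : M, ContDiffOn ℝ ∞ (inChart g p) (extChartAt I p).target

/-- Christoffel symbols of the first kind of a metric `G` on (an open subset of) `E`, see
`christoffelLower_apply`. -/
def christoffelLower (G : E → E →L[ℝ] E →L[ℝ] ℝ) (y : E) : E →L[ℝ] E →L[ℝ] E →L[ℝ] ℝ :=
  (1 / 2 : ℝ) • (fderiv ℝ G y + (fderiv ℝ G y).flip -
    ((ContinuousLinearMap.flipₗᵢ ℝ E E ℝ).toContinuousLinearEquiv.toContinuousLinearMap ∘L
      (fderiv ℝ G y).flip : E →L[ℝ] E →L[ℝ] E →L[ℝ] ℝ))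

theorem christoffelLower_apply (G : E → E →L[ℝ] E →L[ℝ] ℝ) (y v w z : E) :
    christoffelLower G y v w z =
      (1 / 2 : ℝ) * (fderiv ℝ G y v w z + fderiv ℝ G y w v z - fderiv ℝ G y z v w) := rfl

/-- Christoffel symbols `Γ_y (v, w)` of the Levi-Civita connection of `G`: the index of
`christoffelLower` is raised with the inverse of `G y : E → E^*`. -/
def christoffel (G : E → E →L[ℝ] E →L[ℝ] ℝ) (y : E) : E →L[ℝ] E →L[ℝ] E :=
  (ContinuousLinearMap.compL ℝ E (E →L[ℝ] ℝ) E (G y).inverse) ∘L christoffelLower G y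

theorem christoffel_apply (G : E → E →L[ℝ] E →L[ℝ] ℝ) (y v w : E) :
    christoffel G y v w = (G y).inverse (christoffelLower G y v w) := rfl

/-- The endomorphism `z ↦ R (z, v) w` of the Riemann curvature tensor
`R (z, v) w = ∇_z ∇_v w - ∇_v ∇_z w - ∇_{[z, v]} w` of `G` at `y`, see `curvature_apply`. -/
def curvature (G : E → E →L[ℝ] E →L[ℝ] ℝ) (y v w : E) : E →L[ℝ] E :=
  ((fderiv ℝ (christoffel G) y).flip v).flip w - (fderiv ℝ (christoffel G) y v).flip w
    + (christoffel G y).flip (christoffel G y v w)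
    - (christoffel G y v) ∘L (christoffel G y).flip w

theorem curvature_apply (G : E → E →L[ℝ] E →L[ℝ] ℝ) (y v w z : E) :
    curvature G y v w z =
      fderiv ℝ (christoffel G) y z v w - fderiv ℝ (christoffel G) y v z w
        + christoffel G y z (christoffel G y v w)
        - christoffel G y v (christoffel G y z w) := rfl

/-- The Ricci tensor `Ric_g (v, w) = trace (z ↦ R (z, v) w)` at `p`. A tangent vector at `p` is
represented, as always for `TangentSpace I p`, by its coordinates in the preferred chart at `p`;
the curvature is computed in this chart. -/
def ricci (g : BilinField I M) (p : M) (v w : TangentSpace I p) : ℝ :=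
  LinearMap.trace ℝ E (curvature (inChart g p) (extChartAt I p p) v w : E →ₗ[ℝ] E)

/-- The Hessian of a function `a` on (an open subset of) `E` with respect to a metric `G`, see
`localHess_apply`. -/
def localHess (G : E → E →L[ℝ] E →L[ℝ] ℝ) (a : E → ℝ) (y : E) : E →L[ℝ] E →L[ℝ] ℝ :=
  fderiv ℝ (fderiv ℝ a) y -
    (ContinuousLinearMap.compL ℝ E E ℝ (fderiv ℝ a y)) ∘L christoffel G y

theorem localHess_apply (G : E → E →L[ℝ] E →L[ℝ] ℝ) (a : E → ℝ) (y v w : E) :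
    localHess G a y v w =
      fderiv ℝ (fderiv ℝ a) y v w - fderiv ℝ a y (christoffel G y v w) := rfl

/-- The Hessian `Hess_g a = ∇ da` at `p`, computed in the preferred chart at `p`. -/
def hess (g : BilinField I M) (a : M → ℝ) (p : M) :
    TangentSpace I p →L[ℝ] TangentSpace I p →L[ℝ] ℝ :=
  (localHess (inChart g p) (fun y => a ((extChartAt I p).symm y)) (extChartAt I p p) :
    E →L[ℝ] E →L[ℝ] ℝ)

/-- The differential of a real function. -/
def differential (I : ModelWithCorners ℝ E H) (a : M → ℝ) (p : M) : TangentSpace I p →L[ℝ] ℝ :=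
  mfderiv I 𝓘(ℝ, ℝ) a p

/-- The gradient of a real function: `g (grad a, ·) = da`. -/
def grad (g : BilinField I M) (a : M → ℝ) (p : M) : TangentSpace I p :=
  (g p).inverse (differential I a p)

/-- The tension field of a real function, `τ_g u = trace_g (∇ du)`. -/
def tension (g : BilinField I M) (u : M → ℝ) (p : M) : ℝ :=
  LinearMap.trace ℝ (TangentSpace I p)
    ((g p).inverse ∘L hess g u p : TangentSpace I p →L[ℝ] TangentSpace I p).toLinearMap

/-- `(M, g)`, with the real-valued map `u`, the potential `h` and the constants `θ ≥ 0` and `lam`,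
is a gradient Ricci-harmonic soliton. -/
structure IsGRHS (g : BilinField I M) (u h : M → ℝ) (θ lam : ℝ) : Prop where
  isSemiRiemannian : IsSemiRiemannian g
  theta_nonneg : 0 ≤ θ
  smooth_map : ContMDiff I 𝓘(ℝ, ℝ) ∞ u
  smooth_potential : ContMDiff I 𝓘(ℝ, ℝ) ∞ h
  ricci_eq : ∀ (p : M) (v w : TangentSpace I p),
    ricci g p v w + hess g h p v w - θ * (differential I u p v * differential I u p w)
      = lam * g p v w
  tension_eq : ∀ p : M, tension g u p - g p (grad g u p) (grad g h p) = 0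

/-- `Ric_g = μ g`. -/
def IsEinstein (g : BilinField I M) (μ : ℝ) : Prop :=
  ∀ (p : M) (v w : TangentSpace I p), ricci g p v w = μ * g p v w

/-- The warped product metric `π^* g_B + (f ∘ π)^2 σ^* g_F` on `B × F`. -/
def warpedMetric (gB : BilinField I M) (f : M → ℝ) (gF : BilinField I' M') :
    BilinField (I.prod I') (M × M') := fun p =>
  pullback (I' := I.prod I') Prod.fst gB p + (f p.1) ^ 2 • pullback (I' := I.prod I') Prod.snd gF p

end General

section Base

variable {n : ℕ}

/-- The linear function `ξ (x) = ∑ α_i x_i` on `ℝ^n`. -/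
def xi (α : Fin n → ℝ) (x : EuclideanSpace ℝ (Fin n)) : ℝ := ∑ i, α i * x i

/-- The semi-Euclidean bilinear form `∑ ε_i v_i w_i` on `ℝ^n`. -/
def semiEuclidean (ε : Fin n → ℝ) :
    EuclideanSpace ℝ (Fin n) →L[ℝ] EuclideanSpace ℝ (Fin n) →L[ℝ] ℝ :=
  ∑ i, ε i • (EuclideanSpace.proj i : EuclideanSpace ℝ (Fin n) →L[ℝ] ℝ).smulRight
    (EuclideanSpace.proj i : EuclideanSpace ℝ (Fin n) →L[ℝ] ℝ)

theorem semiEuclidean_apply (ε : Fin n → ℝ) (v w : EuclideanSpace ℝ (Fin n)) :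
    semiEuclidean ε v w = ∑ i, ε i * (v i * w i) := by
  simp [semiEuclidean]

/-- The metric `Φ^{-2} g_0` on `ℝ^n`, where `g_0 = ∑ ε_i dx_i^2`. -/
def conformalMetric (ε : Fin n → ℝ) (Φ : EuclideanSpace ℝ (Fin n) → ℝ) :
    BilinField (𝓡 n) (EuclideanSpace ℝ (Fin n)) := fun x =>
  ((Φ x ^ 2)⁻¹ • semiEuclidean ε :
    EuclideanSpace ℝ (Fin n) →L[ℝ] EuclideanSpace ℝ (Fin n) →L[ℝ] ℝ)

/-- The squared semi-Euclidean length `‖α‖² = ∑ ε_i α_i²`. -/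
def sqLength (ε α : Fin n → ℝ) : ℝ := ∑ i, ε i * α i ^ 2

end Base

/-- The system of ordinary differential equations, at the point `t`, for the functions
`φ, f, h, u` of one variable; `N` stands for `‖α‖²`. -/
structure SolvesSystemAt (n m : ℕ) (N θ lam μ : ℝ) (φ f h u : ℝ → ℝ) (t : ℝ) : Prop where
  eq1 : ((n : ℝ) - 2) * (deriv (deriv φ) t / φ t) - m * (deriv (deriv f) t / f t)
      - 2 * m * (deriv φ t / φ t) * (deriv f t / f t) + deriv (deriv h) t
      + 2 * (deriv φ t / φ t) * deriv h t - θ * deriv u t ^ 2 = 0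
  eq2 : (deriv (deriv φ) t / φ t - ((n : ℝ) - 1) * (deriv φ t / φ t) ^ 2
      + m * (deriv φ t / φ t) * (deriv f t / f t) - deriv φ t / φ t * deriv h t) * N
      = lam / φ t ^ 2
  eq3 : (deriv (deriv f) t / f t - ((n : ℝ) - 2) * (deriv φ t / φ t) * (deriv f t / f t)
      + ((m : ℝ) - 1) * (deriv f t / f t) ^ 2 - deriv f t / f t * deriv h t) * N
      = μ / (f t ^ 2 * φ t ^ 2) - lam / φ t ^ 2
  eq4 : (deriv (deriv u) t - ((n : ℝ) - 2) * (deriv φ t / φ t) * deriv u t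
      + m * deriv u t * (deriv f t / f t) - deriv u t * deriv h t) * N = 0

end GRHS

end

/-!
The transformation laws of the curvature under a conformal change and under a warped product,
computed in charts from the Christoffel symbols, turn the soliton tensor
`Ric + Hess h - θ dU ⊗ dU - λ g` into `A(ξ) dξ ⊗ dξ + B(ξ) g₀ + (Ric_F - c(ξ) g_F)` for explicit
functions `A`, `B`, `c` of one variable, and the tension equation into a scalar equation in `ξ`.
If the tensor vanishes, fibre vectors give `Ric_F = c(t) g_F` for every `t`, so that `c` is a
constant `μ`. On base vectors `A dξ ⊗ dξ + B g₀ = 0`; for `n ≥ 2` the kernel of `dξ` is nonzero and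
`g₀` is nondegenerate, so `B = 0` and then `A = 0`. For `n = 1` only the sum of the two terms is
determined, and the converse implication alone survives.
-/

namespace GRHS

open Module (finrank)

section LinearAlgebra

variable {E E' : Type*} [NormedAddCommGroup E] [NormedSpace ℝ E] [FiniteDimensional ℝ E]
  [NormedAddCommGroup E'] [NormedSpace ℝ E'] [FiniteDimensional ℝ E']

theorem isInvertible_of_nondegenerate {b : E →L[ℝ] E →L[ℝ] ℝ}
    (hb : ∀ v, (∀ w, b v w = 0) → v = 0) : b.IsInvertible := by
  have hinj : Function.Injective (b : E →ₗ[ℝ] E →L[ℝ] ℝ) :=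
    (injective_iff_map_eq_zero _).2 fun v hv => hb v fun w => congr($hv w)
  have hdim : finrank ℝ E = finrank ℝ (E →L[ℝ] ℝ) :=
    (Subspace.dual_finrank_eq (K := ℝ) (V := E)).symm.trans
      (LinearMap.toContinuousLinearMap : (E →ₗ[ℝ] ℝ) ≃ₗ[ℝ] _).finrank_eq
  exact ⟨(LinearEquiv.ofInjectiveOfFinrankEq _ hinj hdim).toContinuousLinearEquiv, rfl⟩

theorem trace_eq_trace_fst_add_trace_snd (L : E × E' →L[ℝ] E × E') :
    LinearMap.trace ℝ (E × E') L =
      LinearMap.trace ℝ E (.fst ℝ E E' ∘L L ∘L .inl ℝ E E' : E →L[ℝ] E) +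
      LinearMap.trace ℝ E' (.snd ℝ E E' ∘L L ∘L .inr ℝ E E' : E' →L[ℝ] E') := by
  have h : (L : E × E' →ₗ[ℝ] E × E') =
      LinearMap.inl ℝ E E' ∘ₗ (LinearMap.fst ℝ E E' ∘ₗ L) +
        LinearMap.inr ℝ E E' ∘ₗ (LinearMap.snd ℝ E E' ∘ₗ L) := by
    ext x <;> simp
  conv_lhs => rw [h]
  rw [map_add, LinearMap.trace_comp_comm', LinearMap.trace_comp_comm' _ (LinearMap.inr ℝ E E')]
  rfl

theorem coeffs_eq_zero_of_rankOne_add_nondegenerate {ξ : E →L[ℝ] ℝ} {g₀ : E →L[ℝ] E →L[ℝ] ℝ}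
    (hE : 2 ≤ finrank ℝ E) (hξ : ξ ≠ 0) (hg₀ : ∀ v, (∀ w, g₀ v w = 0) → v = 0) {a b : ℝ}
    (h : ∀ v w, a * (ξ v * ξ w) + b * g₀ v w = 0) : a = 0 ∧ b = 0 := by
  have hker : LinearMap.ker (ξ : E →ₗ[ℝ] ℝ) ≠ ⊥ :=
    LinearMap.ker_ne_bot_of_finrank_lt (by rw [Module.finrank_self]; omega)
  obtain ⟨v, hv, hv0⟩ := Submodule.exists_mem_ne_zero_of_ne_bot hker
  obtain ⟨w, hw⟩ : ∃ w, g₀ v w ≠ 0 := by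
    by_contra! hv'
    exact hv0 (hg₀ v hv')
  have hb : b = 0 := by
    have hξv : ξ v = 0 := hv
    simpa [hξv, hw] using h v w
  obtain ⟨x, hx⟩ : ∃ x, ξ x ≠ 0 := by
    by_contra! hx
    exact hξ (ContinuousLinearMap.ext hx)
  exact ⟨by simpa [hb, hx] using h x x, hb⟩

end LinearAlgebra

section LocalMetric

variable {E : Type*} [NormedAddCommGroup E] [NormedSpace ℝ E]

section

variable {F₁ F₂ F₃ : Type*} [NormedAddCommGroup F₁] [NormedSpace ℝ F₁]
  [NormedAddCommGroup F₂] [NormedSpace ℝ F₂] [NormedAddCommGroup F₃] [NormedSpace ℝ F₃]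
  {B : E → F₁ →L[ℝ] F₂ →L[ℝ] F₃} {y : E}

theorem hasFDerivAt_apply₂ (hB : DifferentiableAt ℝ B y) (v : F₁) (w : F₂) :
    HasFDerivAt (fun x => B x v w) (((fderiv ℝ B y).flip v).flip w) y := by
  refine ((hB.hasFDerivAt.clm_apply (hasFDerivAt_const v y)).clm_apply
    (hasFDerivAt_const w y)).congr_fderiv ?_
  ext; simp

theorem fderiv_apply₂ (hB : DifferentiableAt ℝ B y) (z : E) (v : F₁) (w : F₂) :
    fderiv ℝ B y z v w = fderiv ℝ (fun x => B x v w) y z := by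
  rw [(hasFDerivAt_apply₂ hB v w).fderiv]
  rfl

end

/-- The Ricci tensor of a metric `G` on (an open subset of) `E`. -/
noncomputable def localRicci (G : E → E →L[ℝ] E →L[ℝ] ℝ) (y v w : E) : ℝ :=
  LinearMap.trace ℝ E (curvature G y v w : E →ₗ[ℝ] E)

/-- The gradient of a function `a` on (an open subset of) `E` with respect to a metric `G`. -/
noncomputable def localGrad (G : E → E →L[ℝ] E →L[ℝ] ℝ) (a : E → ℝ) (y : E) : E :=
  (G y).inverse (fderiv ℝ a y)

/-- The Hessian endomorphism `v ↦ ∇_v (grad a)`, which is the Hessian with one index raised. -/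
noncomputable def localHessEnd (G : E → E →L[ℝ] E →L[ℝ] ℝ) (a : E → ℝ) (y : E) : E →L[ℝ] E :=
  (G y).inverse ∘L localHess G a y

/-- The Laplacian `trace_G (Hess a)` of a function `a` on (an open subset of) `E`. -/
noncomputable def localLaplacian (G : E → E →L[ℝ] E →L[ℝ] ℝ) (a : E → ℝ) (y : E) : ℝ :=
  LinearMap.trace ℝ E (localHessEnd G a y : E →ₗ[ℝ] E)

section Congr

variable {G G' : E → E →L[ℝ] E →L[ℝ] ℝ} {y : E}

theorem christoffel_congr (h : G =ᶠ[nhds y] G') : christoffel G =ᶠ[nhds y] christoffel G' := by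
  filter_upwards [h.eventuallyEq_nhds] with x hx
  unfold christoffel christoffelLower
  rw [hx.fderiv_eq, hx.eq_of_nhds]

theorem localRicci_congr (h : G =ᶠ[nhds y] G') : localRicci G y = localRicci G' y := by
  have h' := christoffel_congr h
  unfold localRicci curvature
  rw [h'.fderiv_eq, h'.eq_of_nhds]

theorem localGrad_congr (h : G =ᶠ[nhds y] G') (a : E → ℝ) :
    localGrad G a y = localGrad G' a y := by
  rw [localGrad, localGrad, h.eq_of_nhds]

theorem localHess_congr (h : G =ᶠ[nhds y] G') (a : E → ℝ) :
    localHess G a y = localHess G' a y := by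
  unfold localHess
  rw [(christoffel_congr h).eq_of_nhds]

theorem localLaplacian_congr (h : G =ᶠ[nhds y] G') (a : E → ℝ) :
    localLaplacian G a y = localLaplacian G' a y := by
  rw [localLaplacian, localLaplacian, localHessEnd, localHessEnd, localHess_congr h, h.eq_of_nhds]

end Congr

/-- `G` is a semi-Riemannian metric on the open subset `V` of a vector space. Outside `V` the
field `G` is arbitrary. -/
structure IsMetricOn (G : E → E →L[ℝ] E →L[ℝ] ℝ) (V : Set E) : Prop where
  isOpen : IsOpen V
  smooth : ContDiffOn ℝ ∞ G V
  symm : ∀ y ∈ V, ∀ v w, G y v w = G y w v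
  nondegenerate : ∀ y ∈ V, ∀ v, (∀ w, G y v w = 0) → v = 0

end LocalMetric

namespace IsMetricOn

section

variable {E : Type*} [NormedAddCommGroup E] [NormedSpace ℝ E]
  {G : E → E →L[ℝ] E →L[ℝ] ℝ} {V : Set E} {y : E} (hG : IsMetricOn G V) (hy : y ∈ V)

include hG

theorem congr {G' : E → E →L[ℝ] E →L[ℝ] ℝ} (h : Set.EqOn G' G V) : IsMetricOn G' V where
  isOpen := hG.isOpen
  smooth := hG.smooth.congr h
  symm y hy := h hy ▸ hG.symm y hy
  nondegenerate y hy := h hy ▸ hG.nondegenerate y hy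

include hy

theorem contDiffAt : ContDiffAt ℝ ∞ G y :=
  hG.smooth.contDiffAt (hG.isOpen.mem_nhds hy)

theorem differentiableAt : DifferentiableAt ℝ G y :=
  (hG.contDiffAt hy).differentiableAt (by simp)

theorem contDiffAt_of_contDiffOn {a : E → ℝ} (ha : ContDiffOn ℝ ∞ a V) : ContDiffAt ℝ ∞ a y :=
  ha.contDiffAt (hG.isOpen.mem_nhds hy)

theorem hasFDerivAt {a : E → ℝ} (ha : ContDiffOn ℝ ∞ a V) : HasFDerivAt a (fderiv ℝ a y) y :=
  ((hG.contDiffAt_of_contDiffOn hy ha).differentiableAt (by simp)).hasFDerivAt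

theorem hasFDerivAt_fderiv {a : E → ℝ} (ha : ContDiffOn ℝ ∞ a V) :
    HasFDerivAt (fderiv ℝ a) (fderiv ℝ (fderiv ℝ a) y) y :=
  (((hG.contDiffAt_of_contDiffOn hy ha).fderiv_right (m := 1)
    (by norm_cast)).differentiableAt (by simp)).hasFDerivAt

theorem fderiv_comm (z v w : E) : fderiv ℝ G y z v w = fderiv ℝ G y z w v := by
  rw [fderiv_apply₂ (hG.differentiableAt hy), fderiv_apply₂ (hG.differentiableAt hy)]
  refine congr($(Filter.EventuallyEq.fderiv_eq ?_) z)
  filter_upwards [hG.isOpen.mem_nhds hy] with x hx using hG.symm x hx v w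

theorem christoffel_comm (v w : E) : christoffel G y v w = christoffel G y w v := by
  rw [christoffel_apply, christoffel_apply]
  congr 1
  ext z
  rw [christoffelLower_apply, christoffelLower_apply, hG.fderiv_comm hy z]
  ring

theorem localHess_comm {a : E → ℝ} (ha : ContDiffOn ℝ ∞ a V) (v w : E) :
    localHess G a y v w = localHess G a y w v := by
  have h : IsSymmSndFDerivAt ℝ a y :=
    (hG.contDiffAt_of_contDiffOn hy ha).isSymmSndFDerivAt (by simp; norm_cast)
  rw [localHess_apply, localHess_apply, h v w, hG.christoffel_comm hy]

end

variable {E : Type*} [NormedAddCommGroup E] [NormedSpace ℝ E] [FiniteDimensional ℝ E]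
  {G : E → E →L[ℝ] E →L[ℝ] ℝ} {V : Set E} {y : E} (hG : IsMetricOn G V) (hy : y ∈ V)

include hG hy

theorem isInvertible : (G y).IsInvertible :=
  isInvertible_of_nondegenerate (hG.nondegenerate y hy)

theorem christoffel_eq_iff (v w X : E) :
    christoffel G y v w = X ↔ ∀ z, G y X z = christoffelLower G y v w z := by
  rw [christoffel_apply, (hG.isInvertible hy).inverse_apply_eq, eq_comm,
    ContinuousLinearMap.ext_iff]

theorem christoffel_left (v w z : E) :
    G y (christoffel G y v w) z = christoffelLower G y v w z :=
  (hG.christoffel_eq_iff hy v w _).1 rfl z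

theorem localGrad_eq_iff (a : E → ℝ) (X : E) :
    localGrad G a y = X ↔ ∀ w, G y X w = fderiv ℝ a y w := by
  rw [localGrad, (hG.isInvertible hy).inverse_apply_eq, eq_comm, ContinuousLinearMap.ext_iff]

theorem localGrad_left (a : E → ℝ) (w : E) : G y (localGrad G a y) w = fderiv ℝ a y w :=
  (hG.localGrad_eq_iff hy a _).1 rfl w

theorem localGrad_right (a : E → ℝ) (w : E) : G y w (localGrad G a y) = fderiv ℝ a y w := by
  rw [hG.symm y hy, hG.localGrad_left hy]

theorem localHessEnd_eq_iff (a : E → ℝ) (v X : E) :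
    localHessEnd G a y v = X ↔ ∀ w, G y X w = localHess G a y v w := by
  rw [localHessEnd, ContinuousLinearMap.comp_apply, (hG.isInvertible hy).inverse_apply_eq, eq_comm,
    ContinuousLinearMap.ext_iff]

theorem localHessEnd_left (a : E → ℝ) (v w : E) :
    G y (localHessEnd G a y v) w = localHess G a y v w :=
  (hG.localHessEnd_eq_iff hy a v _).1 rfl w

theorem differentiableAt_christoffel : DifferentiableAt ℝ (christoffel G) y := by
  have : CompleteSpace E := FiniteDimensional.complete ℝ E
  have h1 : DifferentiableAt ℝ (fderiv ℝ G) y :=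
    ((hG.contDiffAt hy).fderiv_right (m := 1) (by norm_cast)).differentiableAt (by simp)
  have h2 : DifferentiableAt ℝ (fun x => (fderiv ℝ G x).flip) y :=
    (ContinuousLinearMap.flipₗᵢ ℝ E E
      (E →L[ℝ] ℝ)).toContinuousLinearEquiv.differentiableAt.comp y h1
  have h3 : DifferentiableAt ℝ (christoffelLower G) y := by
    unfold christoffelLower
    fun_prop
  have h4 : DifferentiableAt ℝ (fun x => (G x).inverse) y :=
    (((hG.isInvertible hy).contDiffAt_map_inverse (n := 1)).differentiableAt (by simp)).comp y
      (hG.differentiableAt hy)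
  unfold christoffel
  fun_prop

theorem fderiv_eq_christoffel (z v w : E) :
    fderiv ℝ G y z v w = G y (christoffel G y z v) w + G y v (christoffel G y z w) := by
  rw [hG.symm y hy v, hG.christoffel_left hy, hG.christoffel_left hy, christoffelLower_apply,
    christoffelLower_apply, hG.fderiv_comm hy z w v, hG.fderiv_comm hy w z v,
    hG.fderiv_comm hy v z w]
  ring

theorem hasFDerivAt_localGrad {a : E → ℝ} (ha : ContDiffOn ℝ ∞ a V) :
    HasFDerivAt (localGrad G a)
      (localHessEnd G a y - (christoffel G y).flip (localGrad G a y)) y := by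
  have : CompleteSpace E := FiniteDimensional.complete ℝ E
  have hda := hG.hasFDerivAt_fderiv hy ha
  have hgrad : DifferentiableAt ℝ (localGrad G a) y :=
    ((((hG.isInvertible hy).contDiffAt_map_inverse (n := 1)).differentiableAt (by simp)).comp y
      (hG.differentiableAt hy)).clm_apply hda.differentiableAt
  refine hgrad.hasFDerivAt.congr_fderiv (ContinuousLinearMap.ext fun z => ?_)
  rw [sub_apply, eq_sub_iff_add_eq, eq_comm, hG.localHessEnd_eq_iff hy]
  intro w
  have hw : (fun x => G x (localGrad G a x) w) =ᶠ[nhds y] fun x => fderiv ℝ a x w := by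
    filter_upwards [hG.isOpen.mem_nhds hy] with x hx using hG.localGrad_left hx a w
  have key := congr($(hw.fderiv_eq (𝕜 := ℝ)) z)
  rw [(((hG.differentiableAt hy).hasFDerivAt.clm_apply hgrad.hasFDerivAt).clm_apply
    (hasFDerivAt_const w y)).fderiv, (hda.clm_apply (hasFDerivAt_const w y)).fderiv] at key
  simp only [ContinuousLinearMap.comp_zero, zero_add, ContinuousLinearMap.flip_apply,
    add_apply, ContinuousLinearMap.comp_apply,
    hG.fderiv_eq_christoffel hy, hG.localGrad_left hy] at key
  rw [map_add, add_apply, ContinuousLinearMap.flip_apply, localHess_apply]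
  linarith

end IsMetricOn

section Conformal

variable {E : Type*} [NormedAddCommGroup E] [NormedSpace ℝ E]
  {G : E → E →L[ℝ] E →L[ℝ] ℝ} {φ : E → ℝ} {V : Set E} {y : E}

/-- The metric `φ⁻² G`, conformal to the metric `G` on (an open subset of) `E`. -/
noncomputable def localConformal (G : E → E →L[ℝ] E →L[ℝ] ℝ) (φ : E → ℝ) (x : E) :
    E →L[ℝ] E →L[ℝ] ℝ :=
  (φ x ^ 2)⁻¹ • G x

theorem localConformal_apply (x v w : E) :
    localConformal G φ x v w = (φ x ^ 2)⁻¹ * G x v w := rfl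

theorem IsMetricOn.localConformal (hG : IsMetricOn G V) (hφ : ContDiffOn ℝ ∞ φ V)
    (hφ0 : ∀ x ∈ V, φ x ≠ 0) : IsMetricOn (localConformal G φ) V where
  isOpen := hG.isOpen
  smooth := ((hφ.pow 2).inv fun x hx => pow_ne_zero 2 (hφ0 x hx)).smul hG.smooth
  symm x hx v w := by rw [localConformal_apply, localConformal_apply, hG.symm x hx]
  nondegenerate x hx v hv := hG.nondegenerate x hx v fun w => by
    simpa [localConformal_apply, hφ0 x hx] using hv w

variable [FiniteDimensional ℝ E] (hG : IsMetricOn G V) (hφ : ContDiffOn ℝ ∞ φ V)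
  (hφ0 : ∀ x ∈ V, φ x ≠ 0) (hy : y ∈ V)

include hG hφ hφ0 hy

theorem christoffel_localConformal (v w : E) :
    christoffel (localConformal G φ) y v w = christoffel G y v w -
      (φ y)⁻¹ • (fderiv ℝ φ y v • w + fderiv ℝ φ y w • v - G y v w • localGrad G φ y) := by
  have hy0 := hφ0 y hy
  have hfderiv (z v w : E) : fderiv ℝ (localConformal G φ) y z v w =
      (φ y ^ 2)⁻¹ * fderiv ℝ G y z v w - 2 * (φ y ^ 3)⁻¹ * fderiv ℝ φ y z * G y v w := by
    have h : HasFDerivAt (localConformal G φ) _ y :=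
      (((hasDerivAt_pow 2 (φ y)).fun_inv (pow_ne_zero 2 hy0)).comp_hasFDerivAt y
        (hG.hasFDerivAt hy hφ)).smul (hG.differentiableAt hy).hasFDerivAt
    rw [h.fderiv]
    simp only [Function.comp_apply, Nat.cast_ofNat, Nat.add_one_sub_one, pow_one, add_apply,
      smul_apply, ContinuousLinearMap.smulRight_apply, smul_eq_mul]
    field_simp
    ring
  rw [(hG.localConformal hφ hφ0).christoffel_eq_iff hy]
  intro z
  simp only [localConformal_apply, map_sub, map_smul, map_add, sub_apply, smul_apply, add_apply,
    smul_eq_mul, hG.christoffel_left hy, hG.localGrad_left hy, christoffelLower_apply, hfderiv]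
  field_simp
  ring

theorem localGrad_localConformal (a : E → ℝ) :
    localGrad (localConformal G φ) a y = φ y ^ 2 • localGrad G a y := by
  rw [(hG.localConformal hφ hφ0).localGrad_eq_iff hy]
  intro w
  simp [localConformal_apply, hG.localGrad_left hy, hφ0 y hy]

theorem localHess_localConformal (a : E → ℝ) (v w : E) :
    localHess (localConformal G φ) a y v w = localHess G a y v w +
      (φ y)⁻¹ * (fderiv ℝ φ y v * fderiv ℝ a y w + fderiv ℝ φ y w * fderiv ℝ a y v -
        G y v w * fderiv ℝ a y (localGrad G φ y)) := by
  rw [localHess_apply, localHess_apply, christoffel_localConformal hG hφ hφ0 hy]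
  simp only [map_sub, map_smul, map_add, smul_eq_mul]
  ring

theorem localLaplacian_localConformal (a : E → ℝ) :
    localLaplacian (localConformal G φ) a y = φ y ^ 2 * (localLaplacian G a y -
      ((finrank ℝ E : ℝ) - 2) * ((φ y)⁻¹ * fderiv ℝ φ y (localGrad G a y))) := by
  have h : localHessEnd (localConformal G φ) a y = φ y ^ 2 • (localHessEnd G a y +
      (φ y)⁻¹ • ((fderiv ℝ φ y).smulRight (localGrad G a y) +
        (fderiv ℝ a y).smulRight (localGrad G φ y) -
        fderiv ℝ a y (localGrad G φ y) • ContinuousLinearMap.id ℝ E)) := by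
    ext v
    rw [(hG.localConformal hφ hφ0).localHessEnd_eq_iff hy]
    intro w
    have hy0 := hφ0 y hy
    simp only [localConformal_apply, localHess_localConformal hG hφ hφ0 hy, hG.localGrad_left hy,
      hG.localHessEnd_left hy, add_apply, smul_apply, sub_apply,
      ContinuousLinearMap.smulRight_apply, ContinuousLinearMap.id_apply, map_add, map_smul, map_sub,
      smul_eq_mul]
    field_simp
  have hcomm : fderiv ℝ a y (localGrad G φ y) = fderiv ℝ φ y (localGrad G a y) := by
    rw [← hG.localGrad_left hy, hG.localGrad_right hy]
  rw [localLaplacian, h, localLaplacian]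
  simp only [hcomm, ContinuousLinearMap.toLinearMap_add, ContinuousLinearMap.toLinearMap_smul,
    ContinuousLinearMap.toLinearMap_sub, ContinuousLinearMap.coe_smulRight,
    ContinuousLinearMap.coe_id, ContinuousLinearMap.coe_coe, map_add, map_smul, map_sub,
    smul_eq_mul, LinearMap.trace_smulRight, LinearMap.trace_id]
  ring

theorem fderiv_christoffel_localConformal (z v w : E) :
    fderiv ℝ (christoffel (localConformal G φ)) y z v w = fderiv ℝ (christoffel G) y z v w +
      ((φ y)⁻¹ ^ 2 * fderiv ℝ φ y z) •
        (fderiv ℝ φ y v • w + fderiv ℝ φ y w • v - G y v w • localGrad G φ y) -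
      (φ y)⁻¹ • (fderiv ℝ (fderiv ℝ φ) y z v • w + fderiv ℝ (fderiv ℝ φ) y z w • v -
        fderiv ℝ G y z v w • localGrad G φ y -
        G y v w • (localHessEnd G φ y z - christoffel G y z (localGrad G φ y))) := by
  have hΓ : (fun x => christoffel (localConformal G φ) x v w) =ᶠ[nhds y] fun x =>
      christoffel G x v w - (φ x)⁻¹ •
        (fderiv ℝ φ x v • w + fderiv ℝ φ x w • v - G x v w • localGrad G φ x) := by
    filter_upwards [hG.isOpen.mem_nhds hy] with x hx using
      christoffel_localConformal hG hφ hφ0 hx v w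
  have hdφ := hG.hasFDerivAt_fderiv hy hφ
  have hinv := (hasDerivAt_inv (hφ0 y hy)).comp_hasFDerivAt y (hG.hasFDerivAt hy hφ)
  have h : HasFDerivAt (fun x => christoffel (localConformal G φ) x v w) _ y :=
    ((hasFDerivAt_apply₂ (hG.differentiableAt_christoffel hy) v w).sub
      (hinv.smul ((((hdφ.clm_apply (hasFDerivAt_const v y)).smul_const w).add
          ((hdφ.clm_apply (hasFDerivAt_const w y)).smul_const v)).sub
        ((hasFDerivAt_apply₂ (hG.differentiableAt hy) v w).smul
          (hG.hasFDerivAt_localGrad hy hφ))))).congr_of_eventuallyEq hΓ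
  rw [fderiv_apply₂ ((hG.localConformal hφ hφ0).differentiableAt_christoffel hy), h.fderiv]
  simp only [Function.comp_apply, ContinuousLinearMap.comp_zero, zero_add, neg_smul, Pi.sub_apply,
    Pi.add_apply, Pi.smul_apply', sub_apply, ContinuousLinearMap.flip_apply, add_apply, smul_apply,
    ContinuousLinearMap.smulRight_apply, neg_apply, smul_eq_mul, inv_pow]
  module

theorem curvature_localConformal (v w z : E) :
    curvature (localConformal G φ) y v w z = curvature G y v w z +
      (φ y)⁻¹ • (localHess G φ y v w • z - localHess G φ y z w • v +
        G y v w • localHessEnd G φ y z - G y z w • localHessEnd G φ y v) +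
      ((φ y)⁻¹ ^ 2 * fderiv ℝ φ y (localGrad G φ y)) • (G y z w • v - G y v w • z) := by
  have hHess (z v : E) : fderiv ℝ (fderiv ℝ φ) y z v =
      localHess G φ y z v + fderiv ℝ φ y (christoffel G y z v) := by
    rw [localHess_apply, sub_add_cancel]
  simp only [curvature_apply, fderiv_christoffel_localConformal hG hφ hφ0 hy,
    christoffel_localConformal hG hφ hφ0 hy, hG.fderiv_eq_christoffel hy, hHess, map_sub, map_add,
    map_smul, hG.localGrad_right hy, smul_eq_mul, hG.christoffel_comm hy v z,
    hG.localHess_comm hy hφ v z, hG.symm y hy v z]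
  module

theorem localRicci_localConformal (v w : E) :
    localRicci (localConformal G φ) y v w = localRicci G y v w +
      ((finrank ℝ E : ℝ) - 2) * ((φ y)⁻¹ * localHess G φ y v w) +
      ((φ y)⁻¹ * localLaplacian G φ y - ((finrank ℝ E : ℝ) - 1) *
        ((φ y)⁻¹ ^ 2 * fderiv ℝ φ y (localGrad G φ y))) * G y v w := by
  have h : curvature (localConformal G φ) y v w = curvature G y v w +
      (φ y)⁻¹ • (localHess G φ y v w • ContinuousLinearMap.id ℝ E -
        ((localHess G φ y).flip w).smulRight v + G y v w • localHessEnd G φ y -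
        ((G y).flip w).smulRight (localHessEnd G φ y v)) +
      ((φ y)⁻¹ ^ 2 * fderiv ℝ φ y (localGrad G φ y)) •
        (((G y).flip w).smulRight v - G y v w • ContinuousLinearMap.id ℝ E) := by
    ext z
    simpa using curvature_localConformal hG hφ hφ0 hy v w z
  rw [localRicci, h, localRicci, localLaplacian]
  simp only [ContinuousLinearMap.toLinearMap_add, ContinuousLinearMap.toLinearMap_smul,
    ContinuousLinearMap.toLinearMap_sub, ContinuousLinearMap.coe_smulRight,
    ContinuousLinearMap.coe_id, ContinuousLinearMap.coe_coe, ContinuousLinearMap.flip_apply,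
    map_add, map_smul, map_sub, smul_eq_mul, LinearMap.trace_smulRight, LinearMap.trace_id,
    hG.localHessEnd_left hy]
  ring

end Conformal

section Warped

variable {E E' : Type*} [NormedAddCommGroup E] [NormedSpace ℝ E]
  [NormedAddCommGroup E'] [NormedSpace ℝ E']
  {G : E → E →L[ℝ] E →L[ℝ] ℝ} {f : E → ℝ} {V : Set E}
  {G' : E' → E' →L[ℝ] E' →L[ℝ] ℝ} {V' : Set E'} {p : E × E'}

/-- The warped product metric `G + f² G'` on (an open subset of) `E × E'`, where `f` is a function
of the first factor. -/
noncomputable def localWarped (G : E → E →L[ℝ] E →L[ℝ] ℝ) (f : E → ℝ)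
    (G' : E' → E' →L[ℝ] E' →L[ℝ] ℝ) (p : E × E') : E × E' →L[ℝ] E × E' →L[ℝ] ℝ :=
  pullbackForm (G p.1) (.fst ℝ E E') + f p.1 ^ 2 • pullbackForm (G' p.2) (.snd ℝ E E')

theorem localWarped_apply (p v w : E × E') :
    localWarped G f G' p v w = G p.1 v.1 w.1 + f p.1 ^ 2 * G' p.2 v.2 w.2 := rfl

theorem IsMetricOn.localWarped [FiniteDimensional ℝ E] [FiniteDimensional ℝ E']
    (hG : IsMetricOn G V) (hf : ContDiffOn ℝ ∞ f V) (hf0 : ∀ x ∈ V, f x ≠ 0)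
    (hG' : IsMetricOn G' V') : IsMetricOn (localWarped G f G') (V ×ˢ V') where
  isOpen := hG.isOpen.prod hG'.isOpen
  smooth := contDiffOn_clm_apply.2 fun v => contDiffOn_clm_apply.2 fun w => by
    have hfst : Set.MapsTo Prod.fst (V ×ˢ V') V := fun p hp => hp.1
    have hsnd : Set.MapsTo Prod.snd (V ×ˢ V') V' := fun p hp => hp.2
    have h := hG.smooth.comp contDiff_fst.contDiffOn hfst
    have h' := hG'.smooth.comp contDiff_snd.contDiffOn hsnd
    exact ((h.clm_apply contDiffOn_const).clm_apply contDiffOn_const).add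
      (((hf.comp contDiff_fst.contDiffOn hfst).pow 2).mul
        ((h'.clm_apply contDiffOn_const).clm_apply contDiffOn_const))
  symm p hp v w := by
    rw [localWarped_apply, localWarped_apply, hG.symm _ hp.1, hG'.symm _ hp.2]
  nondegenerate p hp v hv := by
    refine Prod.ext (hG.nondegenerate _ hp.1 _ fun w => ?_) (hG'.nondegenerate _ hp.2 _ fun w => ?_)
    · simpa [localWarped_apply] using hv (w, 0)
    · simpa [localWarped_apply, hf0 _ hp.1] using hv (0, w)

theorem hasFDerivAt_comp_fst {F : Type*} [NormedAddCommGroup F] [NormedSpace ℝ F] {k : E → F}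
    {k' : E →L[ℝ] F} (h : HasFDerivAt k k' p.1) :
    HasFDerivAt (fun q : E × E' => k q.1) (k' ∘L .fst ℝ E E') p :=
  h.comp p hasFDerivAt_fst

theorem hasFDerivAt_comp_snd {F : Type*} [NormedAddCommGroup F] [NormedSpace ℝ F] {k : E' → F}
    {k' : E' →L[ℝ] F} (h : HasFDerivAt k k' p.2) :
    HasFDerivAt (fun q : E × E' => k q.2) (k' ∘L .snd ℝ E E') p :=
  h.comp p hasFDerivAt_snd

variable [FiniteDimensional ℝ E] [FiniteDimensional ℝ E']
  (hG : IsMetricOn G V) (hf : ContDiffOn ℝ ∞ f V) (hf0 : ∀ x ∈ V, f x ≠ 0)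
  (hG' : IsMetricOn G' V') (hp : p ∈ V ×ˢ V')

include hG hf hf0 hG' hp

theorem fderiv_localWarped (z v w : E × E') :
    fderiv ℝ (localWarped G f G') p z v w = fderiv ℝ G p.1 z.1 v.1 w.1 +
      2 * f p.1 * fderiv ℝ f p.1 z.1 * G' p.2 v.2 w.2 +
      f p.1 ^ 2 * fderiv ℝ G' p.2 z.2 v.2 w.2 := by
  have h : HasFDerivAt (fun q => localWarped G f G' q v w) _ p :=
    (hasFDerivAt_comp_fst (hasFDerivAt_apply₂ (hG.differentiableAt hp.1) v.1 w.1)).add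
      ((hasFDerivAt_comp_fst ((hG.hasFDerivAt hp.1 hf).pow 2)).mul
        (hasFDerivAt_comp_snd (hasFDerivAt_apply₂ (hG'.differentiableAt hp.2) v.2 w.2)))
  rw [fderiv_apply₂ ((hG.localWarped hf hf0 hG').differentiableAt hp), h.fderiv]
  simp only [pullbackForm, ContinuousLinearMap.coe_coe, ContinuousLinearMap.bilinearComp_apply,
    ContinuousLinearMap.coe_fst', ContinuousLinearMap.coe_snd', ContinuousLinearMap.smul_comp,
    ContinuousLinearMap.comp_apply, ContinuousLinearMap.flip_apply, add_apply, smul_apply,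
    Nat.add_one_sub_one, pow_one, nsmul_eq_mul, Nat.cast_ofNat, smul_eq_mul]
  ring

theorem christoffel_localWarped (v w : E × E') :
    christoffel (localWarped G f G') p v w =
      (christoffel G p.1 v.1 w.1 - (f p.1 * G' p.2 v.2 w.2) • localGrad G f p.1,
        christoffel G' p.2 v.2 w.2 +
          (f p.1)⁻¹ • (fderiv ℝ f p.1 v.1 • w.2 + fderiv ℝ f p.1 w.1 • v.2)) := by
  have hp0 := hf0 _ hp.1
  rw [(hG.localWarped hf hf0 hG').christoffel_eq_iff hp]
  intro z
  simp only [localWarped_apply, map_sub, map_smul, map_add, sub_apply, smul_apply, add_apply,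
    smul_eq_mul, hG.christoffel_left hp.1, hG'.christoffel_left hp.2, hG.localGrad_left hp.1,
    christoffelLower_apply, fderiv_localWarped hG hf hf0 hG' hp]
  field_simp
  ring

theorem localGrad_localWarped_comp_fst {a : E → ℝ} (ha : ContDiffOn ℝ ∞ a V) :
    localGrad (localWarped G f G') (a ∘ Prod.fst) p = (localGrad G a p.1, 0) := by
  rw [(hG.localWarped hf hf0 hG').localGrad_eq_iff hp]
  intro w
  have h : HasFDerivAt (a ∘ Prod.fst) _ p := hasFDerivAt_comp_fst (hG.hasFDerivAt hp.1 ha)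
  rw [h.fderiv, localWarped_apply]
  simp [hG.localGrad_left hp.1]

theorem localHess_localWarped_comp_fst {a : E → ℝ} (ha : ContDiffOn ℝ ∞ a V) (v w : E × E') :
    localHess (localWarped G f G') (a ∘ Prod.fst) p v w = localHess G a p.1 v.1 w.1 +
      f p.1 * fderiv ℝ a p.1 (localGrad G f p.1) * G' p.2 v.2 w.2 := by
  have h : fderiv ℝ (a ∘ Prod.fst) =ᶠ[nhds p] fun q => fderiv ℝ a q.1 ∘L .fst ℝ E E' := by
    filter_upwards [(hG.isOpen.prod hG'.isOpen).mem_nhds hp] with q hq using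
      (hasFDerivAt_comp_fst (hG.hasFDerivAt hq.1 ha)).fderiv
  have h' : HasFDerivAt (fun q : E × E' => fderiv ℝ a q.1 ∘L .fst ℝ E E') _ p :=
    (hasFDerivAt_comp_fst (hG.hasFDerivAt_fderiv hp.1 ha)).clm_comp (hasFDerivAt_const _ p)
  rw [localHess_apply, h.fderiv_eq, h'.fderiv, h.eq_of_nhds,
    christoffel_localWarped hG hf hf0 hG' hp, localHess_apply]
  simp only [ContinuousLinearMap.comp_zero, zero_add, ContinuousLinearMap.comp_apply,
    ContinuousLinearMap.coe_fst', ContinuousLinearMap.flip_apply, ContinuousLinearMap.compL_apply,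
    map_sub, map_smul, smul_eq_mul]
  ring

theorem localLaplacian_localWarped_comp_fst {a : E → ℝ} (ha : ContDiffOn ℝ ∞ a V) :
    localLaplacian (localWarped G f G') (a ∘ Prod.fst) p = localLaplacian G a p.1 +
      (finrank ℝ E' : ℝ) * ((f p.1)⁻¹ * fderiv ℝ a p.1 (localGrad G f p.1)) := by
  have h : localHessEnd (localWarped G f G') (a ∘ Prod.fst) p =
      (localHessEnd G a p.1).prodMap
        (((f p.1)⁻¹ * fderiv ℝ a p.1 (localGrad G f p.1)) • ContinuousLinearMap.id ℝ E') := by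
    refine ContinuousLinearMap.ext fun v => ?_
    rw [(hG.localWarped hf hf0 hG').localHessEnd_eq_iff hp]
    intro w
    simp only [localWarped_apply, localHess_localWarped_comp_fst hG hf hf0 hG' hp ha,
      hG.localHessEnd_left hp.1, ContinuousLinearMap.coe_prodMap', Prod.map_fst, Prod.map_snd,
      smul_apply, ContinuousLinearMap.id_apply, map_smul, smul_eq_mul]
    field_simp [hf0 _ hp.1]
  rw [localLaplacian, h, ContinuousLinearMap.coe_prodMap, LinearMap.trace_prodMap', localLaplacian]
  simp [mul_comm]

theorem fderiv_christoffel_localWarped (z v w : E × E') :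
    fderiv ℝ (christoffel (localWarped G f G')) p z v w =
      (fderiv ℝ (christoffel G) p.1 z.1 v.1 w.1 -
          (fderiv ℝ f p.1 z.1 * G' p.2 v.2 w.2 + f p.1 * fderiv ℝ G' p.2 z.2 v.2 w.2) •
            localGrad G f p.1 -
          (f p.1 * G' p.2 v.2 w.2) •
            (localHessEnd G f p.1 z.1 - christoffel G p.1 z.1 (localGrad G f p.1)),
        fderiv ℝ (christoffel G') p.2 z.2 v.2 w.2 -
          ((f p.1)⁻¹ ^ 2 * fderiv ℝ f p.1 z.1) •
            (fderiv ℝ f p.1 v.1 • w.2 + fderiv ℝ f p.1 w.1 • v.2) +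
          (f p.1)⁻¹ • (fderiv ℝ (fderiv ℝ f) p.1 z.1 v.1 • w.2 +
            fderiv ℝ (fderiv ℝ f) p.1 z.1 w.1 • v.2)) := by
  have hmetric := hG.localWarped hf hf0 hG'
  have hΓ : (fun q => christoffel (localWarped G f G') q v w) =ᶠ[nhds p] fun q =>
      (christoffel G q.1 v.1 w.1 - (f q.1 * G' q.2 v.2 w.2) • localGrad G f q.1,
        christoffel G' q.2 v.2 w.2 +
          (f q.1)⁻¹ • (fderiv ℝ f q.1 v.1 • w.2 + fderiv ℝ f q.1 w.1 • v.2)) := by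
    filter_upwards [hmetric.isOpen.mem_nhds hp] with q hq using
      christoffel_localWarped hG hf hf0 hG' hq v w
  have hf1 : HasFDerivAt (fun q : E × E' => f q.1) _ p :=
    hasFDerivAt_comp_fst (hG.hasFDerivAt hp.1 hf)
  have hdf (x : E) : HasFDerivAt (fun q : E × E' => fderiv ℝ f q.1 x) _ p :=
    hasFDerivAt_comp_fst ((hG.hasFDerivAt_fderiv hp.1 hf).clm_apply (hasFDerivAt_const x _))
  have hfst := (hasFDerivAt_comp_fst (E' := E')
    (hasFDerivAt_apply₂ (hG.differentiableAt_christoffel hp.1) v.1 w.1)).sub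
    ((hf1.mul (hasFDerivAt_comp_snd
      (hasFDerivAt_apply₂ (hG'.differentiableAt hp.2) v.2 w.2))).smul
      (hasFDerivAt_comp_fst (hG.hasFDerivAt_localGrad hp.1 hf)))
  have hsnd := (hasFDerivAt_comp_snd (E := E)
    (hasFDerivAt_apply₂ (hG'.differentiableAt_christoffel hp.2) v.2 w.2)).add
    (((hasDerivAt_inv (hf0 _ hp.1)).comp_hasFDerivAt p hf1).smul
      (((hdf v.1).smul_const w.2).add ((hdf w.1).smul_const v.2)))
  have h : HasFDerivAt (fun q => christoffel (localWarped G f G') q v w) _ p :=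
    (hfst.prodMk hsnd).congr_of_eventuallyEq hΓ
  rw [fderiv_apply₂ (hmetric.differentiableAt_christoffel hp), h.fderiv]
  simp only [Pi.mul_apply, ContinuousLinearMap.sub_comp, Function.comp_apply,
    ContinuousLinearMap.comp_zero, zero_add, smul_add, neg_smul, Pi.add_apply,
    ContinuousLinearMap.prod_apply, sub_apply, ContinuousLinearMap.comp_apply,
    ContinuousLinearMap.coe_fst', ContinuousLinearMap.coe_snd', ContinuousLinearMap.flip_apply,
    add_apply, smul_apply, ContinuousLinearMap.smulRight_apply, smul_eq_mul, neg_apply, inv_pow,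
    Prod.mk.injEq]
  constructor <;> module

theorem curvature_localWarped_inl (v w : E × E') (z : E) :
    (curvature (localWarped G f G') p v w (z, 0)).1 = curvature G p.1 v.1 w.1 z -
      (f p.1 * G' p.2 v.2 w.2) • localHessEnd G f p.1 z := by
  have hp0 := hf0 _ hp.1
  simp only [curvature_apply, fderiv_christoffel_localWarped hG hf hf0 hG' hp,
    christoffel_localWarped hG hf hf0 hG' hp, hG'.fderiv_eq_christoffel hp.2]
  simp only [map_zero, zero_apply, zero_add, add_zero, zero_sub, sub_zero, mul_zero, zero_smul,
    smul_zero, smul_add, neg_add_rev, inv_pow, map_sub, map_smul, smul_eq_mul, Prod.mk_sub_mk,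
    Prod.mk_add_mk]
  match_scalars <;> field_simp <;> ring

theorem curvature_localWarped_inr (v w : E × E') (z : E') :
    (curvature (localWarped G f G') p v w (0, z)).2 = curvature G' p.2 v.2 w.2 z -
      ((f p.1)⁻¹ * localHess G f p.1 v.1 w.1 +
        G' p.2 v.2 w.2 * fderiv ℝ f p.1 (localGrad G f p.1)) • z +
      (G' p.2 z w.2 * fderiv ℝ f p.1 (localGrad G f p.1)) • v.2 := by
  have hp0 := hf0 _ hp.1
  simp only [curvature_apply, fderiv_christoffel_localWarped hG hf hf0 hG' hp,
    christoffel_localWarped hG hf hf0 hG' hp, hG'.fderiv_eq_christoffel hp.2, localHess_apply]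
  simp only [map_zero, zero_apply, zero_mul, mul_zero, zero_add, add_zero, zero_sub, sub_zero,
    sub_self, zero_smul, smul_zero, smul_add, smul_neg, neg_smul, inv_pow, map_add, map_sub,
    map_neg, map_smul, smul_eq_mul, Prod.mk_sub_mk, Prod.mk_add_mk,
    hG'.christoffel_comm hp.2 v.2 z]
  match_scalars <;> field_simp <;> ring

theorem localRicci_localWarped (v w : E × E') :
    localRicci (localWarped G f G') p v w =
      localRicci G p.1 v.1 w.1 + localRicci G' p.2 v.2 w.2 -
        (finrank ℝ E' : ℝ) * ((f p.1)⁻¹ * localHess G f p.1 v.1 w.1) -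
        (f p.1 * localLaplacian G f p.1 + ((finrank ℝ E' : ℝ) - 1) *
          fderiv ℝ f p.1 (localGrad G f p.1)) * G' p.2 v.2 w.2 := by
  have hinl : .fst ℝ E E' ∘L curvature (localWarped G f G') p v w ∘L .inl ℝ E E' =
      curvature G p.1 v.1 w.1 - (f p.1 * G' p.2 v.2 w.2) • localHessEnd G f p.1 :=
    ContinuousLinearMap.ext fun z => curvature_localWarped_inl hG hf hf0 hG' hp v w z
  have hinr : .snd ℝ E E' ∘L curvature (localWarped G f G') p v w ∘L .inr ℝ E E' =
      curvature G' p.2 v.2 w.2 -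
        ((f p.1)⁻¹ * localHess G f p.1 v.1 w.1 + G' p.2 v.2 w.2 *
          fderiv ℝ f p.1 (localGrad G f p.1)) • ContinuousLinearMap.id ℝ E' +
        fderiv ℝ f p.1 (localGrad G f p.1) • ((G' p.2).flip w.2).smulRight v.2 :=
    ContinuousLinearMap.ext fun z => by
      simpa [smul_smul, mul_comm] using curvature_localWarped_inr hG hf hf0 hG' hp v w z
  rw [localRicci, trace_eq_trace_fst_add_trace_snd, hinl, hinr, localRicci, localRicci,
    localLaplacian]
  simp only [ContinuousLinearMap.toLinearMap_add, ContinuousLinearMap.toLinearMap_smul,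
    ContinuousLinearMap.toLinearMap_sub, ContinuousLinearMap.coe_smulRight,
    ContinuousLinearMap.coe_id, ContinuousLinearMap.coe_coe, ContinuousLinearMap.flip_apply,
    map_add, map_smul, map_sub, smul_eq_mul, LinearMap.trace_smulRight, LinearMap.trace_id]
  ring

end Warped

section Manifold

variable {E : Type*} [NormedAddCommGroup E] [NormedSpace ℝ E]
  {H : Type*} [TopologicalSpace H] {I : ModelWithCorners ℝ E H}
  {M : Type*} [TopologicalSpace M] [ChartedSpace H M]

theorem contDiffOn_comp_extChartAt_symm [IsManifold I ∞ M] {a : M → ℝ}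
    (ha : ContMDiff I 𝓘(ℝ, ℝ) ∞ a) (p : M) :
    ContDiffOn ℝ ∞ (a ∘ (extChartAt I p).symm) (extChartAt I p).target :=
  contMDiffOn_iff_contDiffOn.1 (ha.comp_contMDiffOn (contMDiffOn_extChartAt_symm p))

theorem apply_grad [FiniteDimensional ℝ E] {g : BilinField I M} (hg : IsSemiRiemannian g)
    (a : M → ℝ) (p : M) (w : TangentSpace I p) :
    g p (grad g a p) w = differential I a p w :=
  congr($((isInvertible_of_nondegenerate (E := E) (hg.nondegenerate p)).self_apply_inverse
    (differential I a p)) w)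

/-- The metric `Φ⁻² g`, conformal to the metric `g`. -/
noncomputable def conformal (g : BilinField I M) (Φ : M → ℝ) : BilinField I M := fun p =>
  (Φ p ^ 2)⁻¹ • g p

theorem inChart_conformal (g : BilinField I M) (Φ : M → ℝ) (p : M) :
    inChart (conformal g Φ) p = localConformal (inChart g p) (Φ ∘ (extChartAt I p).symm) := rfl

variable [I.Boundaryless]

theorem mfderiv_extChartAt_symm_self [IsManifold I 1 M] (p : M) :
    (mfderiv 𝓘(ℝ, E) I (extChartAt I p).symm (extChartAt I p p) : E →L[ℝ] E) =
      ContinuousLinearMap.id ℝ E := by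
  have := mfderivWithin_range_extChartAt_symm (I := I) (x := p)
  rwa [I.range_eq_univ, mfderivWithin_univ] at this

theorem isInvertible_mfderiv_extChartAt_symm [IsManifold I 1 M] {p : M} {y : E}
    (hy : y ∈ (extChartAt I p).target) :
    (mfderiv 𝓘(ℝ, E) I (extChartAt I p).symm y).IsInvertible := by
  have := isInvertible_mfderivWithin_extChartAt_symm hy
  rwa [I.range_eq_univ, mfderivWithin_univ] at this

theorem inChart_self [IsManifold I 1 M] (g : BilinField I M) (p : M) :
    inChart g p (extChartAt I p p) = (g p : E →L[ℝ] E →L[ℝ] ℝ) := by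
  have h : ∀ (q : M) (D : E →L[ℝ] E), q = p → D = ContinuousLinearMap.id ℝ E →
      pullbackForm (E := E) (E' := E) (g q) D = (g p : E →L[ℝ] E →L[ℝ] ℝ) := by
    rintro q D rfl rfl
    rfl
  exact h _ _ (extChartAt_to_inv p) (mfderiv_extChartAt_symm_self p)

theorem pullbackForm_nondegenerate {b : E →L[ℝ] E →L[ℝ] ℝ}
    (hb : ∀ v, (∀ w, b v w = 0) → v = 0) {D : E →L[ℝ] E} (hD : D.IsInvertible) (v : E)
    (hv : ∀ w, pullbackForm b D v w = 0) : v = 0 := by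
  refine hD.injective ((hb _ fun w => ?_).trans (map_zero D).symm)
  obtain ⟨z, rfl⟩ := hD.surjective w
  exact hv z

theorem isSemiRiemannian_iff_isMetricOn_inChart [IsManifold I 1 M] {g : BilinField I M} :
    IsSemiRiemannian g ↔ ∀ p, IsMetricOn (inChart g p) (extChartAt I p).target where
  mp hg p :=
    { isOpen := isOpen_extChartAt_target p
      smooth := hg.smooth p
      symm := fun y _ v w => by
        rw [inChart_apply, inChart_apply]
        exact hg.symm _ _ _
      nondegenerate := fun y hy v hv => pullbackForm_nondegenerate (E := E)
        (hg.nondegenerate ((extChartAt I p).symm y))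
        (isInvertible_mfderiv_extChartAt_symm hy) v hv }
  mpr h :=
    { symm := fun p v w => by
        have := (h p).symm _ (mem_extChartAt_target p) v w
        rwa [inChart_self] at this
      nondegenerate := fun p v hv => by
        refine (h p).nondegenerate _ (mem_extChartAt_target p) v fun w => ?_
        rw [inChart_self]
        exact hv w
      smooth := fun p => (h p).smooth }

theorem differential_eq_fderiv {a : M → ℝ} (ha : ContMDiff I 𝓘(ℝ, ℝ) ∞ a) (p : M) :
    (differential I a p : E →L[ℝ] ℝ) =
      fderiv ℝ (a ∘ (extChartAt I p).symm) (extChartAt I p p) := by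
  have h := (ha.mdifferentiable (by simp) p).mfderiv
  rwa [I.range_eq_univ, fderivWithin_univ] at h

theorem grad_eq_localGrad [IsManifold I 1 M] (g : BilinField I M) {a : M → ℝ}
    (ha : ContMDiff I 𝓘(ℝ, ℝ) ∞ a) (p : M) :
    grad g a p = localGrad (inChart g p) (a ∘ (extChartAt I p).symm) (extChartAt I p p) := by
  rw [localGrad, inChart_self, ← differential_eq_fderiv ha]
  rfl

theorem tension_eq_localLaplacian [IsManifold I 1 M] (g : BilinField I M) (a : M → ℝ) (p : M) :
    tension g a p =
      localLaplacian (inChart g p) (a ∘ (extChartAt I p).symm) (extChartAt I p p) := by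
  rw [localLaplacian, localHessEnd, inChart_self]
  rfl

section Conformal

variable [IsManifold I ∞ M] {g : BilinField I M} {Φ : M → ℝ} (hg : IsSemiRiemannian g)
  (hΦ : ContMDiff I 𝓘(ℝ, ℝ) ∞ Φ) (hΦ0 : ∀ p, Φ p ≠ 0)

include hg hΦ hΦ0

theorem isSemiRiemannian_conformal : IsSemiRiemannian (conformal g Φ) :=
  isSemiRiemannian_iff_isMetricOn_inChart.2 fun p =>
    (isSemiRiemannian_iff_isMetricOn_inChart.1 hg p).localConformal
      (contDiffOn_comp_extChartAt_symm hΦ p) fun _ _ => hΦ0 _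

variable [FiniteDimensional ℝ E]

theorem grad_conformal {a : M → ℝ} (ha : ContMDiff I 𝓘(ℝ, ℝ) ∞ a) (p : M) :
    grad (conformal g Φ) a p = Φ p ^ 2 • grad g a p := by
  have h := localGrad_localConformal (isSemiRiemannian_iff_isMetricOn_inChart.1 hg p)
    (contDiffOn_comp_extChartAt_symm hΦ p) (fun _ _ => hΦ0 _) (mem_extChartAt_target p)
    (a ∘ (extChartAt I p).symm)
  rw [← inChart_conformal, ← grad_eq_localGrad _ ha, ← grad_eq_localGrad _ ha,
    Function.comp_apply, extChartAt_to_inv] at h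
  exact h

theorem hess_conformal {a : M → ℝ} (ha : ContMDiff I 𝓘(ℝ, ℝ) ∞ a) (p : M)
    (v w : TangentSpace I p) :
    hess (conformal g Φ) a p v w = hess g a p v w +
      (Φ p)⁻¹ * (differential I Φ p v * differential I a p w +
        differential I Φ p w * differential I a p v -
        g p v w * differential I a p (grad g Φ p)) := by
  have h := localHess_localConformal (isSemiRiemannian_iff_isMetricOn_inChart.1 hg p)
    (contDiffOn_comp_extChartAt_symm hΦ p) (fun _ _ => hΦ0 _) (mem_extChartAt_target p)
    (a ∘ (extChartAt I p).symm) v w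
  rw [← grad_eq_localGrad _ hΦ, ← differential_eq_fderiv ha, ← differential_eq_fderiv hΦ,
    inChart_self, Function.comp_apply, extChartAt_to_inv] at h
  exact h

theorem tension_conformal {a : M → ℝ} (ha : ContMDiff I 𝓘(ℝ, ℝ) ∞ a) (p : M) :
    tension (conformal g Φ) a p = Φ p ^ 2 * (tension g a p -
      ((finrank ℝ E : ℝ) - 2) * ((Φ p)⁻¹ * differential I Φ p (grad g a p))) := by
  have h := localLaplacian_localConformal (isSemiRiemannian_iff_isMetricOn_inChart.1 hg p)
    (contDiffOn_comp_extChartAt_symm hΦ p) (fun _ _ => hΦ0 _) (mem_extChartAt_target p)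
    (a ∘ (extChartAt I p).symm)
  rw [← inChart_conformal, ← grad_eq_localGrad _ ha, ← differential_eq_fderiv hΦ,
    ← tension_eq_localLaplacian, ← tension_eq_localLaplacian, Function.comp_apply,
    extChartAt_to_inv] at h
  exact h

theorem ricci_conformal (p : M) (v w : TangentSpace I p) :
    ricci (conformal g Φ) p v w = ricci g p v w +
      ((finrank ℝ E : ℝ) - 2) * ((Φ p)⁻¹ * hess g Φ p v w) +
      ((Φ p)⁻¹ * tension g Φ p - ((finrank ℝ E : ℝ) - 1) *
        ((Φ p)⁻¹ ^ 2 * differential I Φ p (grad g Φ p))) * g p v w := by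
  have h := localRicci_localConformal (isSemiRiemannian_iff_isMetricOn_inChart.1 hg p)
    (contDiffOn_comp_extChartAt_symm hΦ p) (fun _ _ => hΦ0 _) (mem_extChartAt_target p) v w
  rw [← grad_eq_localGrad _ hΦ, ← differential_eq_fderiv hΦ, ← tension_eq_localLaplacian,
    inChart_self, Function.comp_apply, extChartAt_to_inv] at h
  exact h

end Conformal

end Manifold

section WarpedMetric

variable {E : Type*} [NormedAddCommGroup E] [NormedSpace ℝ E]
  {H : Type*} [TopologicalSpace H] {I : ModelWithCorners ℝ E H}
  {M : Type*} [TopologicalSpace M] [ChartedSpace H M]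
  {E' : Type*} [NormedAddCommGroup E'] [NormedSpace ℝ E']
  {H' : Type*} [TopologicalSpace H'] {I' : ModelWithCorners ℝ E' H'}
  {M' : Type*} [TopologicalSpace M'] [ChartedSpace H' M']
  {gB : BilinField I M} {f : M → ℝ} {gF : BilinField I' M'}

theorem warpedMetric_apply (p : M × M') (v w : TangentSpace (I.prod I') p) :
    warpedMetric gB f gF p v w = gB p.1 v.1 w.1 + f p.1 ^ 2 * gF p.2 v.2 w.2 := by
  unfold warpedMetric pullback
  rw [mfderiv_fst, mfderiv_snd]
  rfl

theorem target_extChartAt_prod (p : M × M') :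
    (extChartAt (I.prod I') p).target =
      (extChartAt I p.1).target ×ˢ (extChartAt I' p.2).target := by
  rw [extChartAt_prod, PartialEquiv.prod_target]

theorem extChartAt_prod_symm (p : M × M') :
    ⇑(extChartAt (I.prod I') p).symm =
      Prod.map (extChartAt I p.1).symm (extChartAt I' p.2).symm := by
  rw [extChartAt_prod]
  rfl

theorem extChartAt_prod_self (p : M × M') :
    extChartAt (I.prod I') p p = (extChartAt I p.1 p.1, extChartAt I' p.2 p.2) := by
  rw [extChartAt_prod]
  rfl

theorem comp_fst_comp_extChartAt_prod_symm (a : M → ℝ) (p : M × M') :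
    (a ∘ Prod.fst) ∘ (extChartAt (I.prod I') p).symm =
      (a ∘ (extChartAt I p.1).symm) ∘ Prod.fst := by
  rw [extChartAt_prod_symm]
  rfl

variable [I.Boundaryless] [I'.Boundaryless]

theorem mdifferentiableAt_extChartAt_symm [IsManifold I 1 M] {p : M} {y : E}
    (hy : y ∈ (extChartAt I p).target) :
    MDifferentiableAt 𝓘(ℝ, E) I (extChartAt I p).symm y := by
  have := mdifferentiableWithinAt_extChartAt_symm hy
  rwa [I.range_eq_univ, mdifferentiableWithinAt_univ] at this

theorem mfderiv_extChartAt_prod_symm [IsManifold I 1 M] [IsManifold I' 1 M'] (p : M × M')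
    {y : E × E'} (hy : y ∈ (extChartAt (I.prod I') p).target) :
    (mfderiv 𝓘(ℝ, E × E') (I.prod I') (extChartAt (I.prod I') p).symm y :
        E × E' →L[ℝ] E × E') =
      ContinuousLinearMap.prodMap
        (mfderiv 𝓘(ℝ, E) I (extChartAt I p.1).symm y.1 : E →L[ℝ] E)
        (mfderiv 𝓘(ℝ, E') I' (extChartAt I' p.2).symm y.2 : E' →L[ℝ] E') := by
  rw [target_extChartAt_prod] at hy
  rw [extChartAt_prod_symm, modelWithCornersSelf_prod, ← chartedSpaceSelf_prod]
  exact mfderiv_prodMap (mdifferentiableAt_extChartAt_symm hy.1)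
    (mdifferentiableAt_extChartAt_symm hy.2)

theorem inChart_warpedMetric [IsManifold I 1 M] [IsManifold I' 1 M'] (p : M × M') {y : E × E'}
    (hy : y ∈ (extChartAt (I.prod I') p).target) :
    inChart (warpedMetric gB f gF) p y =
      localWarped (inChart gB p.1) (f ∘ (extChartAt I p.1).symm) (inChart gF p.2) y := by
  refine ContinuousLinearMap.ext fun v => ContinuousLinearMap.ext fun w => ?_
  rw [inChart_apply, warpedMetric_apply, mfderiv_extChartAt_prod_symm p hy, extChartAt_prod_symm]
  rfl

theorem inChart_warpedMetric_eventuallyEq [IsManifold I 1 M] [IsManifold I' 1 M'] (p : M × M') :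
    inChart (warpedMetric gB f gF) p =ᶠ[nhds (extChartAt I p.1 p.1, extChartAt I' p.2 p.2)]
      localWarped (inChart gB p.1) (f ∘ (extChartAt I p.1).symm) (inChart gF p.2) := by
  rw [← extChartAt_prod_self]
  filter_upwards [(isOpen_extChartAt_target p).mem_nhds (mem_extChartAt_target p)] with y hy using
    inChart_warpedMetric p hy

variable [FiniteDimensional ℝ E] [FiniteDimensional ℝ E'] [IsManifold I ∞ M] [IsManifold I' ∞ M']
  (hgB : IsSemiRiemannian gB) (hf : ContMDiff I 𝓘(ℝ, ℝ) ∞ f) (hf0 : ∀ x, f x ≠ 0)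
  (hgF : IsSemiRiemannian gF)

include hgB hf hf0 hgF

theorem isSemiRiemannian_warpedMetric : IsSemiRiemannian (warpedMetric gB f gF) := by
  refine isSemiRiemannian_iff_isMetricOn_inChart.2 fun p => ?_
  have h := (isSemiRiemannian_iff_isMetricOn_inChart.1 hgB p.1).localWarped
    (contDiffOn_comp_extChartAt_symm hf p.1) (fun _ _ => hf0 _)
    (isSemiRiemannian_iff_isMetricOn_inChart.1 hgF p.2)
  rw [← target_extChartAt_prod] at h
  exact h.congr fun y hy => inChart_warpedMetric p hy

theorem grad_warpedMetric_comp_fst {a : M → ℝ} (ha : ContMDiff I 𝓘(ℝ, ℝ) ∞ a) (p : M × M') :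
    grad (warpedMetric gB f gF) (a ∘ Prod.fst) p = (grad gB a p.1, 0) := by
  have h := localGrad_localWarped_comp_fst (isSemiRiemannian_iff_isMetricOn_inChart.1 hgB p.1)
    (contDiffOn_comp_extChartAt_symm hf p.1) (fun _ _ => hf0 _)
    (isSemiRiemannian_iff_isMetricOn_inChart.1 hgF p.2)
    (p := (extChartAt I p.1 p.1, extChartAt I' p.2 p.2))
    ⟨mem_extChartAt_target p.1, mem_extChartAt_target p.2⟩ (contDiffOn_comp_extChartAt_symm ha p.1)
  dsimp only at h
  rw [← localGrad_congr (inChart_warpedMetric_eventuallyEq p),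
    ← comp_fst_comp_extChartAt_prod_symm (I' := I') a p,
    ← extChartAt_prod_self (I := I) (I' := I') p,
    ← grad_eq_localGrad _ (ha.comp contMDiff_fst), ← grad_eq_localGrad _ ha] at h
  exact h

theorem hess_warpedMetric_comp_fst {a : M → ℝ} (ha : ContMDiff I 𝓘(ℝ, ℝ) ∞ a) (p : M × M')
    (v w : TangentSpace (I.prod I') p) :
    hess (warpedMetric gB f gF) (a ∘ Prod.fst) p v w = hess gB a p.1 v.1 w.1 +
      f p.1 * differential I a p.1 (grad gB f p.1) * gF p.2 v.2 w.2 := by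
  have h := localHess_localWarped_comp_fst (isSemiRiemannian_iff_isMetricOn_inChart.1 hgB p.1)
    (contDiffOn_comp_extChartAt_symm hf p.1) (fun _ _ => hf0 _)
    (isSemiRiemannian_iff_isMetricOn_inChart.1 hgF p.2)
    (p := (extChartAt I p.1 p.1, extChartAt I' p.2 p.2))
    ⟨mem_extChartAt_target p.1, mem_extChartAt_target p.2⟩
    (contDiffOn_comp_extChartAt_symm ha p.1) v w
  dsimp only at h
  rw [← localHess_congr (inChart_warpedMetric_eventuallyEq p),
    ← comp_fst_comp_extChartAt_prod_symm (I' := I') a p,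
    ← extChartAt_prod_self (I := I) (I' := I') p, ← grad_eq_localGrad _ hf,
    ← differential_eq_fderiv ha, inChart_self, Function.comp_apply, extChartAt_to_inv] at h
  exact h

theorem tension_warpedMetric_comp_fst {a : M → ℝ} (ha : ContMDiff I 𝓘(ℝ, ℝ) ∞ a) (p : M × M') :
    tension (warpedMetric gB f gF) (a ∘ Prod.fst) p = tension gB a p.1 +
      (finrank ℝ E' : ℝ) * ((f p.1)⁻¹ * differential I a p.1 (grad gB f p.1)) := by
  have h := localLaplacian_localWarped_comp_fst
    (isSemiRiemannian_iff_isMetricOn_inChart.1 hgB p.1)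
    (contDiffOn_comp_extChartAt_symm hf p.1) (fun _ _ => hf0 _)
    (isSemiRiemannian_iff_isMetricOn_inChart.1 hgF p.2)
    (p := (extChartAt I p.1 p.1, extChartAt I' p.2 p.2))
    ⟨mem_extChartAt_target p.1, mem_extChartAt_target p.2⟩ (contDiffOn_comp_extChartAt_symm ha p.1)
  dsimp only at h
  rw [← localLaplacian_congr (inChart_warpedMetric_eventuallyEq p),
    ← comp_fst_comp_extChartAt_prod_symm (I' := I') a p,
    ← extChartAt_prod_self (I := I) (I' := I') p, ← tension_eq_localLaplacian,
    ← tension_eq_localLaplacian, ← grad_eq_localGrad _ hf, ← differential_eq_fderiv ha,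
    Function.comp_apply, extChartAt_to_inv] at h
  exact h

theorem ricci_warpedMetric (p : M × M') (v w : TangentSpace (I.prod I') p) :
    ricci (warpedMetric gB f gF) p v w =
      ricci gB p.1 v.1 w.1 + ricci gF p.2 v.2 w.2 -
        (finrank ℝ E' : ℝ) * ((f p.1)⁻¹ * hess gB f p.1 v.1 w.1) -
        (f p.1 * tension gB f p.1 + ((finrank ℝ E' : ℝ) - 1) *
          differential I f p.1 (grad gB f p.1)) * gF p.2 v.2 w.2 := by
  have h := localRicci_localWarped (isSemiRiemannian_iff_isMetricOn_inChart.1 hgB p.1)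
    (contDiffOn_comp_extChartAt_symm hf p.1) (fun _ _ => hf0 _)
    (isSemiRiemannian_iff_isMetricOn_inChart.1 hgF p.2)
    (p := (extChartAt I p.1 p.1, extChartAt I' p.2 p.2))
    ⟨mem_extChartAt_target p.1, mem_extChartAt_target p.2⟩ v w
  dsimp only at h
  rw [← localRicci_congr (inChart_warpedMetric_eventuallyEq p),
    ← extChartAt_prod_self (I := I) (I' := I') p,
    ← tension_eq_localLaplacian, ← grad_eq_localGrad _ hf, ← differential_eq_fderiv hf,
    inChart_self, Function.comp_apply, extChartAt_to_inv] at h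
  exact h

end WarpedMetric

section Base

variable {E : Type*} [NormedAddCommGroup E] [NormedSpace ℝ E] {g₀ : E →L[ℝ] E →L[ℝ] ℝ}

/-- The flat metric on a vector space given by a bilinear form. -/
def flat (g₀ : E →L[ℝ] E →L[ℝ] ℝ) : BilinField 𝓘(ℝ, E) E := fun _ => g₀

theorem inChart_flat (x : E) : inChart (flat g₀) x = fun _ => g₀ := by
  funext y
  refine ContinuousLinearMap.ext fun v => ContinuousLinearMap.ext fun w => ?_
  rw [inChart_apply, extChartAt_model_space_eq_id, PartialEquiv.refl_symm, PartialEquiv.refl_coe,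
    mfderiv_id]
  rfl

theorem isSemiRiemannian_flat (hsymm : ∀ v w, g₀ v w = g₀ w v)
    (hnd : ∀ v, (∀ w, g₀ v w = 0) → v = 0) : IsSemiRiemannian (flat g₀) where
  symm _ := hsymm
  nondegenerate _ := hnd
  smooth x := by
    rw [inChart_flat]
    exact contDiffOn_const

theorem christoffel_const : christoffel (fun _ : E => g₀) = 0 := by
  funext y
  refine ContinuousLinearMap.ext fun v => ContinuousLinearMap.ext fun w => ?_
  have h : christoffelLower (fun _ : E => g₀) y v w = 0 := by
    ext z
    simp [christoffelLower_apply]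
  rw [christoffel_apply, h, map_zero]
  rfl

theorem ricci_flat (x v w : E) : ricci (flat g₀) x v w = 0 := by
  have h : curvature (fun _ : E => g₀) (extChartAt 𝓘(ℝ, E) x x) v w = 0 := by
    ext z
    simp [curvature_apply, christoffel_const]
  unfold ricci
  rw [inChart_flat, h]
  exact map_zero _

variable {ξ : E →L[ℝ] ℝ} {k : ℝ → ℝ}

theorem contMDiff_comp_clm (hk : ContDiff ℝ ∞ k) : ContMDiff 𝓘(ℝ, E) 𝓘(ℝ, ℝ) ∞ (k ∘ ξ) :=
  (hk.comp ξ.contDiff).contMDiff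

theorem hasFDerivAt_comp_clm (hk : ContDiff ℝ ∞ k) (x : E) :
    HasFDerivAt (k ∘ ξ) (deriv k (ξ x) • ξ) x :=
  ((hk.differentiable (by simp) _).hasDerivAt).comp_hasFDerivAt x ξ.hasFDerivAt

theorem differential_comp_clm (hk : ContDiff ℝ ∞ k) (x v : E) :
    differential 𝓘(ℝ, E) (k ∘ ξ) x v = deriv k (ξ x) * ξ v := by
  rw [differential, mfderiv_eq_fderiv, (hasFDerivAt_comp_clm hk x).fderiv]
  rfl

theorem grad_flat_comp_clm (hk : ContDiff ℝ ∞ k) (x : E) :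
    grad (flat g₀) (k ∘ ξ) x = deriv k (ξ x) • g₀.inverse ξ := by
  rw [grad, differential, mfderiv_eq_fderiv, (hasFDerivAt_comp_clm hk x).fderiv]
  exact map_smul g₀.inverse _ _

theorem hess_flat_comp_clm (hk : ContDiff ℝ ∞ k) (x : E) :
    hess (flat g₀) (k ∘ ξ) x = (deriv (deriv k) (ξ x) • ξ.smulRight ξ : E →L[ℝ] E →L[ℝ] ℝ) := by
  have hk' : ContDiff ℝ ∞ (deriv k) := (contDiff_infty_iff_deriv.1 hk).2
  have h : fderiv ℝ (k ∘ ξ) = fun y => (deriv k ∘ ξ) y • ξ :=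
    funext fun y => (hasFDerivAt_comp_clm hk y).fderiv
  have h' : fderiv ℝ (fderiv ℝ (k ∘ ξ)) x = deriv (deriv k) (ξ x) • ξ.smulRight ξ := by
    rw [h, ((hasFDerivAt_comp_clm hk' x).smul_const ξ).fderiv]
    ext
    simp [mul_assoc]
  rw [← h', hess, inChart_flat, localHess, christoffel_const, Pi.zero_apply,
    ContinuousLinearMap.comp_zero, sub_zero, extChartAt_model_space_eq_id]
  rfl

theorem tension_flat_comp_clm [FiniteDimensional ℝ E] (hk : ContDiff ℝ ∞ k) (x : E) :
    tension (flat g₀) (k ∘ ξ) x = deriv (deriv k) (ξ x) * ξ (g₀.inverse ξ) := by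
  have h : (g₀.inverse ∘L (deriv (deriv k) (ξ x) • ξ.smulRight ξ) : E →L[ℝ] E) =
      ξ.smulRight (deriv (deriv k) (ξ x) • g₀.inverse ξ) := by
    ext v
    simp [smul_comm (ξ v)]
  unfold tension
  rw [hess_flat_comp_clm hk]
  refine (congrArg (fun L : E →L[ℝ] E => LinearMap.trace ℝ E L) h).trans ?_
  refine (LinearMap.trace_smulRight _ _).trans ?_
  simp

end Base

section ConformallyFlat

variable {E : Type*} [NormedAddCommGroup E] [NormedSpace ℝ E]
  {g₀ : E →L[ℝ] E →L[ℝ] ℝ} (hg₀ : IsSemiRiemannian (flat g₀)) {ξ : E →L[ℝ] ℝ}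
  {φ k : ℝ → ℝ} (hφ : ContDiff ℝ ∞ φ) (hφ0 : ∀ t, φ t ≠ 0)

theorem conformal_flat_comp_apply (x v w : E) :
    conformal (flat g₀) (φ ∘ ξ) x v w = (φ (ξ x) ^ 2)⁻¹ * g₀ v w := rfl

include hg₀ hφ hφ0

theorem isSemiRiemannian_conformal_flat : IsSemiRiemannian (conformal (flat g₀) (φ ∘ ξ)) :=
  isSemiRiemannian_conformal hg₀ (contMDiff_comp_clm hφ) fun x => hφ0 (ξ x)

variable [FiniteDimensional ℝ E]

theorem ricci_conformal_flat (x v w : E) :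
    ricci (conformal (flat g₀) (φ ∘ ξ)) x v w =
      ((finrank ℝ E : ℝ) - 2) * (deriv (deriv φ) (ξ x) / φ (ξ x)) * (ξ v * ξ w) +
        (deriv (deriv φ) (ξ x) / φ (ξ x) -
          ((finrank ℝ E : ℝ) - 1) * (deriv φ (ξ x) / φ (ξ x)) ^ 2) *
            ξ (g₀.inverse ξ) * g₀ v w := by
  have hR := ricci_conformal hg₀ (contMDiff_comp_clm hφ) (fun x => hφ0 (ξ x)) x v w
  rw [ricci_flat, hess_flat_comp_clm hφ, tension_flat_comp_clm hφ, grad_flat_comp_clm hφ,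
    differential_comp_clm hφ, map_smul] at hR
  refine hR.trans ?_
  change _ + _ * (_ * (deriv (deriv φ) (ξ x) * (ξ v * ξ w))) + _ * g₀ v w = _
  simp only [Function.comp_apply, smul_eq_mul]
  ring

variable (hk : ContDiff ℝ ∞ k)

include hk

theorem grad_conformal_flat_comp (x : E) :
    grad (conformal (flat g₀) (φ ∘ ξ)) (k ∘ ξ) x =
      (φ (ξ x) ^ 2 * deriv k (ξ x)) • g₀.inverse ξ := by
  have h := grad_conformal hg₀ (contMDiff_comp_clm hφ) (fun x => hφ0 (ξ x))
    (contMDiff_comp_clm (ξ := ξ) hk) x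
  rw [grad_flat_comp_clm hk] at h
  exact h.trans (smul_smul _ _ (g₀.inverse ξ))

theorem hess_conformal_flat_comp (x v w : E) :
    hess (conformal (flat g₀) (φ ∘ ξ)) (k ∘ ξ) x v w =
      deriv (deriv k) (ξ x) * (ξ v * ξ w) + deriv φ (ξ x) / φ (ξ x) * deriv k (ξ x) *
        (2 * (ξ v * ξ w) - ξ (g₀.inverse ξ) * g₀ v w) := by
  have h := hess_conformal hg₀ (contMDiff_comp_clm hφ) (fun x => hφ0 (ξ x))
    (contMDiff_comp_clm (ξ := ξ) hk) x v w
  simp only [hess_flat_comp_clm hk, grad_flat_comp_clm hφ, differential_comp_clm hφ,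
    differential_comp_clm hk, map_smul] at h
  refine h.trans ?_
  change deriv (deriv k) (ξ x) * (ξ v * ξ w) + _ * (_ - g₀ v w * _) = _
  simp only [Function.comp_apply, smul_eq_mul]
  ring

theorem tension_conformal_flat_comp (x : E) :
    tension (conformal (flat g₀) (φ ∘ ξ)) (k ∘ ξ) x =
      φ (ξ x) ^ 2 * (deriv (deriv k) (ξ x) - ((finrank ℝ E : ℝ) - 2) *
        (deriv φ (ξ x) / φ (ξ x)) * deriv k (ξ x)) * ξ (g₀.inverse ξ) := by
  have h := tension_conformal hg₀ (contMDiff_comp_clm hφ) (fun x => hφ0 (ξ x))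
    (contMDiff_comp_clm (ξ := ξ) hk) x
  rw [tension_flat_comp_clm hk, grad_flat_comp_clm hk, differential_comp_clm hφ, map_smul] at h
  refine h.trans ?_
  simp only [Function.comp_apply, smul_eq_mul]
  ring

end ConformallyFlat

section Coefficients

variable (n m : ℕ) (θ : ℝ) (φ f h u : ℝ → ℝ) (t : ℝ)

/-- The coefficient of `dξ ⊗ dξ` in the soliton equation, the left-hand side of the first equation
of the system. -/
noncomputable def xiCoeff : ℝ :=
  ((n : ℝ) - 2) * (deriv (deriv φ) t / φ t) - m * (deriv (deriv f) t / f t)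
    - 2 * m * (deriv φ t / φ t) * (deriv f t / f t) + deriv (deriv h) t
    + 2 * (deriv φ t / φ t) * deriv h t - θ * deriv u t ^ 2

/-- The bracket in the second equation of the system: `baseCoeff * N` is the coefficient of `g₀` in
`Ric + Hess h`. -/
noncomputable def baseCoeff : ℝ :=
  deriv (deriv φ) t / φ t - ((n : ℝ) - 1) * (deriv φ t / φ t) ^ 2
    + m * (deriv φ t / φ t) * (deriv f t / f t) - deriv φ t / φ t * deriv h t

/-- The bracket in the third equation of the system: `-f² φ² N * fiberCoeff` is the coefficient of
`g_F` in `Ric - Ric_F + Hess h`. -/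
noncomputable def fiberCoeff : ℝ :=
  deriv (deriv f) t / f t - ((n : ℝ) - 2) * (deriv φ t / φ t) * (deriv f t / f t)
    + ((m : ℝ) - 1) * (deriv f t / f t) ^ 2 - deriv f t / f t * deriv h t

/-- The bracket in the fourth equation of the system: `φ² N * mapCoeff` is the left-hand side of the
tension equation. -/
noncomputable def mapCoeff : ℝ :=
  deriv (deriv u) t - ((n : ℝ) - 2) * (deriv φ t / φ t) * deriv u t
    + m * deriv u t * (deriv f t / f t) - deriv u t * deriv h t

theorem solvesSystemAt_iff {N lam μ : ℝ} :
    SolvesSystemAt n m N θ lam μ φ f h u t ↔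
      xiCoeff n m θ φ f h u t = 0 ∧ baseCoeff n m φ f h t * N = lam / φ t ^ 2 ∧
        fiberCoeff n m φ f h t * N = μ / (f t ^ 2 * φ t ^ 2) - lam / φ t ^ 2 ∧
        mapCoeff n m φ f h u t * N = 0 :=
  ⟨fun ⟨h1, h2, h3, h4⟩ => ⟨h1, h2, h3, h4⟩, fun ⟨h1, h2, h3, h4⟩ => ⟨h1, h2, h3, h4⟩⟩

end Coefficients

section Soliton

variable {E : Type*} [NormedAddCommGroup E] [NormedSpace ℝ E]
  {H' : Type*} [TopologicalSpace H']
  {E' : Type*} [NormedAddCommGroup E'] [NormedSpace ℝ E'] {I' : ModelWithCorners ℝ E' H'}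
  {F : Type*} [TopologicalSpace F] [ChartedSpace H' F]
  {g₀ : E →L[ℝ] E →L[ℝ] ℝ} {ξ : E →L[ℝ] ℝ} {gF : BilinField I' F} {φ f h u k : ℝ → ℝ}

/-- The warped product metric `(φ ∘ ξ)⁻² g₀ + (f ∘ ξ)² g_F`. -/
noncomputable abbrev warpedConformallyFlat (g₀ : E →L[ℝ] E →L[ℝ] ℝ) (ξ : E →L[ℝ] ℝ) (φ f : ℝ → ℝ)
    (gF : BilinField I' F) : BilinField (𝓘(ℝ, E).prod I') (E × F) :=
  warpedMetric (conformal (flat g₀) (φ ∘ ξ)) (f ∘ ξ) gF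

theorem contMDiff_comp_clm_comp_fst (hk : ContDiff ℝ ∞ k) :
    ContMDiff (𝓘(ℝ, E).prod I') 𝓘(ℝ, ℝ) ∞ ((k ∘ ξ) ∘ (Prod.fst : E × F → E)) :=
  (contMDiff_comp_clm hk).comp contMDiff_fst

theorem differential_comp_clm_comp_fst (hk : ContDiff ℝ ∞ k) (p : E × F)
    (v : TangentSpace (𝓘(ℝ, E).prod I') p) :
    differential (𝓘(ℝ, E).prod I') ((k ∘ ξ) ∘ Prod.fst) p v = deriv k (ξ p.1) * ξ v.1 := by
  rw [← differential_comp_clm hk]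
  unfold differential
  rw [mfderiv_comp p ((contMDiff_comp_clm hk).mdifferentiable (by simp) _) mdifferentiableAt_fst,
    mfderiv_fst]
  rfl

variable [FiniteDimensional ℝ E] [FiniteDimensional ℝ E'] [I'.Boundaryless] [IsManifold I' ∞ F]
  (hg₀ : IsSemiRiemannian (flat g₀)) (hgF : IsSemiRiemannian gF)
  (hφ : ContDiff ℝ ∞ φ) (hφ0 : ∀ t, φ t ≠ 0) (hf : ContDiff ℝ ∞ f) (hf0 : ∀ t, f t ≠ 0)
  (hh : ContDiff ℝ ∞ h) (hu : ContDiff ℝ ∞ u)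

include hg₀ hgF hφ hφ0 hf hf0

theorem isSemiRiemannian_warpedConformallyFlat :
    IsSemiRiemannian (warpedConformallyFlat g₀ ξ φ f gF) :=
  isSemiRiemannian_warpedMetric (isSemiRiemannian_conformal_flat hg₀ hφ hφ0)
    (contMDiff_comp_clm hf) (fun x => hf0 (ξ x)) hgF

include hh hu

theorem soliton_tensor_warpedConformallyFlat (θ lam : ℝ) (p : E × F)
    (v w : TangentSpace (𝓘(ℝ, E).prod I') p) :
    ricci (warpedConformallyFlat g₀ ξ φ f gF) p v w
      + hess (warpedConformallyFlat g₀ ξ φ f gF) ((h ∘ ξ) ∘ Prod.fst) p v w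
      - θ * (differential (𝓘(ℝ, E).prod I') ((u ∘ ξ) ∘ Prod.fst) p v *
          differential (𝓘(ℝ, E).prod I') ((u ∘ ξ) ∘ Prod.fst) p w)
      - lam * warpedConformallyFlat g₀ ξ φ f gF p v w =
    xiCoeff (finrank ℝ E) (finrank ℝ E') θ φ f h u (ξ p.1) * (ξ v.1 * ξ w.1)
      + (baseCoeff (finrank ℝ E) (finrank ℝ E') φ f h (ξ p.1) * ξ (g₀.inverse ξ)
          - lam / φ (ξ p.1) ^ 2) * g₀ v.1 w.1
      + (ricci gF p.2 v.2 w.2 - f (ξ p.1) ^ 2 * φ (ξ p.1) ^ 2 *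
          (fiberCoeff (finrank ℝ E) (finrank ℝ E') φ f h (ξ p.1) * ξ (g₀.inverse ξ)
            + lam / φ (ξ p.1) ^ 2) * gF p.2 v.2 w.2) := by
  have hgB := isSemiRiemannian_conformal_flat hg₀ (ξ := ξ) hφ hφ0
  rw [ricci_warpedMetric hgB (contMDiff_comp_clm hf) (fun x => hf0 (ξ x)) hgF,
    hess_warpedMetric_comp_fst hgB (contMDiff_comp_clm hf) (fun x => hf0 (ξ x)) hgF
      (contMDiff_comp_clm hh),
    differential_comp_clm_comp_fst hu, differential_comp_clm_comp_fst hu, warpedMetric_apply,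
    conformal_flat_comp_apply, ricci_conformal_flat hg₀ hφ hφ0,
    hess_conformal_flat_comp hg₀ hφ hφ0 hf,
    hess_conformal_flat_comp hg₀ hφ hφ0 hh, tension_conformal_flat_comp hg₀ hφ hφ0 hf,
    grad_conformal_flat_comp hg₀ hφ hφ0 hf, differential_comp_clm hf, differential_comp_clm hh]
  have hφx := hφ0 (ξ p.1)
  have hfx := hf0 (ξ p.1)
  simp only [Function.comp_apply, map_smul, smul_eq_mul, xiCoeff, baseCoeff, fiberCoeff]
  field_simp
  ring

theorem tension_sub_warpedConformallyFlat (p : E × F) :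
    tension (warpedConformallyFlat g₀ ξ φ f gF) ((u ∘ ξ) ∘ Prod.fst) p
      - warpedConformallyFlat g₀ ξ φ f gF p
          (grad (warpedConformallyFlat g₀ ξ φ f gF) ((u ∘ ξ) ∘ Prod.fst) p)
          (grad (warpedConformallyFlat g₀ ξ φ f gF) ((h ∘ ξ) ∘ Prod.fst) p) =
    φ (ξ p.1) ^ 2 *
      (mapCoeff (finrank ℝ E) (finrank ℝ E') φ f h u (ξ p.1) * ξ (g₀.inverse ξ)) := by
  have hgB := isSemiRiemannian_conformal_flat hg₀ (ξ := ξ) hφ hφ0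
  rw [apply_grad (isSemiRiemannian_warpedConformallyFlat hg₀ hgF hφ hφ0 hf hf0),
    differential_comp_clm_comp_fst hu,
    grad_warpedMetric_comp_fst hgB (contMDiff_comp_clm hf) (fun x => hf0 (ξ x)) hgF
      (contMDiff_comp_clm hh),
    tension_warpedMetric_comp_fst hgB (contMDiff_comp_clm hf) (fun x => hf0 (ξ x)) hgF
      (contMDiff_comp_clm hu),
    tension_conformal_flat_comp hg₀ hφ hφ0 hu, grad_conformal_flat_comp hg₀ hφ hφ0 hf,
    grad_conformal_flat_comp hg₀ hφ hφ0 hh, differential_comp_clm hu]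
  have hφx := hφ0 (ξ p.1)
  have hfx := hf0 (ξ p.1)
  simp only [Function.comp_apply, map_smul, smul_eq_mul, mapCoeff]
  field_simp

end Soliton

theorem surjective_of_ne_zero {E : Type*} [NormedAddCommGroup E] [NormedSpace ℝ E]
    {ξ : E →L[ℝ] ℝ} (hξ : ξ ≠ 0) : Function.Surjective ξ :=
  LinearMap.surjective (f := (ξ : E →ₗ[ℝ] ℝ)) (by exact_mod_cast hξ)

theorem IsEinstein.unique {E : Type*} [NormedAddCommGroup E] [NormedSpace ℝ E] [Nontrivial E]
    {H : Type*} [TopologicalSpace H] {I : ModelWithCorners ℝ E H}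
    {M : Type*} [TopologicalSpace M] [ChartedSpace H M] [Nonempty M] {g : BilinField I M}
    (hg : IsSemiRiemannian g) {μ ν : ℝ} (hμ : IsEinstein g μ) (hν : IsEinstein g ν) : μ = ν := by
  obtain ⟨p⟩ := ‹Nonempty M›
  obtain ⟨v : E, hv⟩ := exists_ne (0 : E)
  obtain ⟨w, hw⟩ : ∃ w, g p v w ≠ 0 := by
    by_contra! h
    exact hv (hg.nondegenerate p v h)
  exact mul_right_cancel₀ hw ((hμ p v w).symm.trans (hν p v w))

section System

variable {E : Type*} [NormedAddCommGroup E] [NormedSpace ℝ E] [FiniteDimensional ℝ E]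
  {H' : Type*} [TopologicalSpace H']
  {E' : Type*} [NormedAddCommGroup E'] [NormedSpace ℝ E'] [FiniteDimensional ℝ E']
  {I' : ModelWithCorners ℝ E' H'} [I'.Boundaryless]
  {F : Type*} [TopologicalSpace F] [ChartedSpace H' F] [IsManifold I' ∞ F]
  {g₀ : E →L[ℝ] E →L[ℝ] ℝ} {ξ : E →L[ℝ] ℝ} {gF : BilinField I' F} {φ f h u : ℝ → ℝ} {θ lam : ℝ}
  (hg₀ : IsSemiRiemannian (flat g₀)) (hgF : IsSemiRiemannian gF)
  (hφ : ContDiff ℝ ∞ φ) (hφ0 : ∀ t, φ t ≠ 0) (hf : ContDiff ℝ ∞ f) (hf0 : ∀ t, f t ≠ 0)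
  (hh : ContDiff ℝ ∞ h) (hu : ContDiff ℝ ∞ u)

include hg₀ hgF hφ hφ0 hf hf0 hh hu

theorem isGRHS_of_solvesSystemAt (hθ : 0 ≤ θ) {μ : ℝ} (hμ : IsEinstein gF μ)
    (hs : ∀ t, SolvesSystemAt (finrank ℝ E) (finrank ℝ E') (ξ (g₀.inverse ξ)) θ lam μ φ f h u t) :
    IsGRHS (warpedConformallyFlat g₀ ξ φ f gF) ((u ∘ ξ) ∘ Prod.fst) ((h ∘ ξ) ∘ Prod.fst) θ lam where
  isSemiRiemannian := isSemiRiemannian_warpedConformallyFlat hg₀ hgF hφ hφ0 hf hf0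
  theta_nonneg := hθ
  smooth_map := contMDiff_comp_clm_comp_fst hu
  smooth_potential := contMDiff_comp_clm_comp_fst hh
  ricci_eq p v w := by
    obtain ⟨h1, h2, h3, -⟩ := (solvesSystemAt_iff ..).1 (hs (ξ p.1))
    have hR : ricci gF p.2 v.2 w.2 = μ * gF p.2 v.2 w.2 := hμ p.2 v.2 w.2
    rw [← sub_eq_zero,
      soliton_tensor_warpedConformallyFlat hg₀ hgF hφ hφ0 hf hf0 hh hu, h1, h2, h3, hR]
    have hφx := hφ0 (ξ p.1)
    have hfx := hf0 (ξ p.1)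
    field_simp
    ring
  tension_eq p := by
    obtain ⟨-, -, -, h4⟩ := (solvesSystemAt_iff ..).1 (hs (ξ p.1))
    rw [tension_sub_warpedConformallyFlat hg₀ hgF hφ hφ0 hf hf0 hh hu, h4, mul_zero]

section

variable (H : IsGRHS (warpedConformallyFlat g₀ ξ φ f gF) ((u ∘ ξ) ∘ Prod.fst)
  ((h ∘ ξ) ∘ Prod.fst) θ lam)

include H

theorem soliton_coefficients_of_isGRHS (p : E × F) (v w : TangentSpace (𝓘(ℝ, E).prod I') p) :
    xiCoeff (finrank ℝ E) (finrank ℝ E') θ φ f h u (ξ p.1) * (ξ v.1 * ξ w.1)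
      + (baseCoeff (finrank ℝ E) (finrank ℝ E') φ f h (ξ p.1) * ξ (g₀.inverse ξ)
          - lam / φ (ξ p.1) ^ 2) * g₀ v.1 w.1
      + (ricci gF p.2 v.2 w.2 - f (ξ p.1) ^ 2 * φ (ξ p.1) ^ 2 *
          (fiberCoeff (finrank ℝ E) (finrank ℝ E') φ f h (ξ p.1) * ξ (g₀.inverse ξ)
            + lam / φ (ξ p.1) ^ 2) * gF p.2 v.2 w.2) = 0 := by
  rw [← soliton_tensor_warpedConformallyFlat hg₀ hgF hφ hφ0 hf hf0 hh hu, H.ricci_eq, sub_self]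

variable (hξ : ξ ≠ 0)

include hξ

theorem isEinstein_of_isGRHS (t : ℝ) :
    IsEinstein gF (f t ^ 2 * φ t ^ 2 * (fiberCoeff (finrank ℝ E) (finrank ℝ E') φ f h t *
      ξ (g₀.inverse ξ) + lam / φ t ^ 2)) := by
  intro q v w
  obtain ⟨x, rfl⟩ := surjective_of_ne_zero hξ t
  have hs := soliton_coefficients_of_isGRHS hg₀ hgF hφ hφ0 hf hf0 hh hu H (x, q)
    ((0, v) : E × E') ((0, w) : E × E')
  simp only [map_zero, mul_zero, zero_add] at hs
  exact sub_eq_zero.1 hs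

theorem baseEquations_of_isGRHS [Nonempty F] (hE : 2 ≤ finrank ℝ E) (t : ℝ) :
    xiCoeff (finrank ℝ E) (finrank ℝ E') θ φ f h u t = 0 ∧
      baseCoeff (finrank ℝ E) (finrank ℝ E') φ f h t * ξ (g₀.inverse ξ) - lam / φ t ^ 2 = 0 := by
  obtain ⟨x, rfl⟩ := surjective_of_ne_zero hξ t
  obtain ⟨q⟩ := ‹Nonempty F›
  refine coeffs_eq_zero_of_rankOne_add_nondegenerate hE hξ (hg₀.nondegenerate x) fun v w => ?_
  have hs := soliton_coefficients_of_isGRHS hg₀ hgF hφ hφ0 hf hf0 hh hu H (x, q)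
    ((v, 0) : E × E') ((w, 0) : E × E')
  have hF := isEinstein_of_isGRHS hg₀ hgF hφ hφ0 hf hf0 hh hu H hξ (ξ x) q 0 0
  exact (add_eq_left.2 (sub_eq_zero.2 hF)).symm.trans hs

theorem mapEquation_of_isGRHS [Nonempty F] (t : ℝ) :
    mapCoeff (finrank ℝ E) (finrank ℝ E') φ f h u t * ξ (g₀.inverse ξ) = 0 := by
  obtain ⟨x, rfl⟩ := surjective_of_ne_zero hξ t
  obtain ⟨q⟩ := ‹Nonempty F›
  have hτ := tension_sub_warpedConformallyFlat (ξ := ξ) hg₀ hgF hφ hφ0 hf hf0 hh hu (x, q)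
  rw [H.tension_eq] at hτ
  exact (mul_eq_zero.1 hτ.symm).resolve_left (pow_ne_zero 2 (hφ0 _))

theorem solvesSystemAt_of_isGRHS [Nonempty F] [Nontrivial E'] (hE : 2 ≤ finrank ℝ E) :
    ∃ μ, IsEinstein gF μ ∧ ∀ t,
      SolvesSystemAt (finrank ℝ E) (finrank ℝ E') (ξ (g₀.inverse ξ)) θ lam μ φ f h u t := by
  have hEin := isEinstein_of_isGRHS hg₀ hgF hφ hφ0 hf hf0 hh hu H hξ
  refine ⟨_, hEin 0, fun t => ?_⟩
  obtain ⟨h1, h2⟩ := baseEquations_of_isGRHS hg₀ hgF hφ hφ0 hf hf0 hh hu H hξ hE t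
  refine (solvesSystemAt_iff ..).2 ⟨h1, sub_eq_zero.1 h2, ?_,
    mapEquation_of_isGRHS hg₀ hgF hφ hφ0 hf hf0 hh hu H hξ t⟩
  rw [IsEinstein.unique hgF (hEin 0) (hEin t), eq_sub_iff_add_eq,
    mul_div_cancel_left₀ _ (mul_ne_zero (pow_ne_zero 2 (hf0 t)) (pow_ne_zero 2 (hφ0 t)))]

end

end System

section SemiEuclidean

variable {n : ℕ} {ε : Fin n → ℝ}

theorem isSemiRiemannian_flat_semiEuclidean (hε : ∀ i, ε i = 1 ∨ ε i = -1) :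
    IsSemiRiemannian (flat (semiEuclidean ε)) := by
  refine isSemiRiemannian_flat (fun v w => ?_) fun v hv => ?_
  · simp only [semiEuclidean_apply, mul_comm]
  · ext i
    have hi := hv (EuclideanSpace.single i 1)
    rw [semiEuclidean_apply, Finset.sum_eq_single i (by simp +contextual) (by simp)] at hi
    rcases hε i with h | h <;> simpa [h] using hi

/-- The linear function `xi α` as a continuous linear functional. -/
noncomputable def xiL (α : Fin n → ℝ) : EuclideanSpace ℝ (Fin n) →L[ℝ] ℝ :=
  ∑ i, α i • EuclideanSpace.proj i

theorem coe_xiL (α : Fin n → ℝ) : ⇑(xiL α) = xi α := by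
  ext x
  simp [xiL, xi]

theorem xiL_ne_zero {α : Fin n → ℝ} (hα : α ≠ 0) : xiL α ≠ 0 := by
  contrapose! hα
  ext i
  simpa [xiL] using congr($hα (EuclideanSpace.single i 1))

theorem xiL_inverse_semiEuclidean (hε : ∀ i, ε i = 1 ∨ ε i = -1) (α : Fin n → ℝ) :
    xiL α ((semiEuclidean ε).inverse (xiL α)) = sqLength ε α := by
  have hgrad : (semiEuclidean ε).inverse (xiL α) = WithLp.toLp 2 fun i => ε i * α i := by
    rw [(isInvertible_of_nondegenerate
      ((isSemiRiemannian_flat_semiEuclidean hε).nondegenerate 0)).inverse_apply_eq]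
    ext w
    rw [semiEuclidean_apply, coe_xiL, xi]
    refine Finset.sum_congr rfl fun i _ => ?_
    rcases hε i with h | h <;> simp [h]
  rw [hgrad, coe_xiL, xi, sqLength]
  exact Finset.sum_congr rfl fun i _ => by ring

end SemiEuclidean

end GRHS

theorem theorem3_general {E : Type*} [NormedAddCommGroup E] [NormedSpace ℝ E]
    [FiniteDimensional ℝ E] {E' : Type*} [NormedAddCommGroup E'] [NormedSpace ℝ E']
    [FiniteDimensional ℝ E'] [Nontrivial E'] {H' : Type*} [TopologicalSpace H']
    {I' : ModelWithCorners ℝ E' H'} [I'.Boundaryless]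
    {F : Type*} [TopologicalSpace F] [ChartedSpace H' F] [IsManifold I' ∞ F] [Nonempty F]
    {g₀ : E →L[ℝ] E →L[ℝ] ℝ} (hg₀ : GRHS.IsSemiRiemannian (GRHS.flat g₀))
    {gF : GRHS.BilinField I' F} (hgF : GRHS.IsSemiRiemannian gF) {ξ : E →L[ℝ] ℝ} (hξ : ξ ≠ 0)
    {φ f h u : ℝ → ℝ} (hφ : ContDiff ℝ ∞ φ) (hf : ContDiff ℝ ∞ f) (hh : ContDiff ℝ ∞ h)
    (hu : ContDiff ℝ ∞ u) (hφ0 : ∀ t, φ t ≠ 0) (hf0 : ∀ t, f t ≠ 0) {θ lam : ℝ} (hθ : 0 ≤ θ)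
    {g : GRHS.BilinField (𝓘(ℝ, E).prod I') (E × F)}
    (hg : g = GRHS.warpedConformallyFlat g₀ ξ φ f gF)
    {U P : E × F → ℝ} (hU : U = (u ∘ ξ) ∘ Prod.fst) (hP : P = (h ∘ ξ) ∘ Prod.fst) :
    (2 ≤ Module.finrank ℝ E →
      ((GRHS.IsGRHS g U P θ lam ∧ ∃ p q, U p ≠ U q) ↔
        ((∃ s t, u s ≠ u t) ∧ ∃ μ : ℝ, GRHS.IsEinstein gF μ ∧
          ∀ t, GRHS.SolvesSystemAt (Module.finrank ℝ E) (Module.finrank ℝ E')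
            (ξ (g₀.inverse ξ)) θ lam μ φ f h u t))) ∧
    (((∃ s t, u s ≠ u t) ∧ ∃ μ : ℝ, GRHS.IsEinstein gF μ ∧
        ∀ t, GRHS.SolvesSystemAt (Module.finrank ℝ E) (Module.finrank ℝ E')
          (ξ (g₀.inverse ξ)) θ lam μ φ f h u t) →
      (GRHS.IsGRHS g U P θ lam ∧ ∃ p q, U p ≠ U q)) := by
  subst hg hU hP
  have hconst : (∃ p q : E × F, u (ξ p.1) ≠ u (ξ q.1)) ↔ ∃ s t, u s ≠ u t :=
    (((GRHS.surjective_of_ne_zero hξ).comp Prod.fst_surjective).exists₂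
      (p := fun s t => u s ≠ u t)).symm
  refine ⟨fun hn => ⟨fun ⟨hS, hU⟩ => ⟨hconst.1 hU, ?_⟩, ?_⟩, ?_⟩
  · exact GRHS.solvesSystemAt_of_isGRHS hg₀ hgF hφ hφ0 hf hf0 hh hu hS hξ hn
  all_goals
    exact fun ⟨hU, _, hμ, hs⟩ =>
      ⟨GRHS.isGRHS_of_solvesSystemAt hg₀ hgF hφ hφ0 hf hf0 hh hu hθ hμ hs, hconst.2 hU⟩

theorem theorem3 {n m : ℕ} (hm : 1 ≤ m)
    {F : Type*} [TopologicalSpace F] [ChartedSpace (EuclideanSpace ℝ (Fin m)) F]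
    [IsManifold (𝓡 m) ∞ F] [Nonempty F]
    (gF : GRHS.BilinField (𝓡 m) F) (hgF : GRHS.IsSemiRiemannian gF)
    (ε α : Fin n → ℝ) (hε : ∀ i, ε i = 1 ∨ ε i = -1) (hα : α ≠ 0)
    (φ f h u : ℝ → ℝ)
    (hφ : ContDiff ℝ ∞ φ) (hf : ContDiff ℝ ∞ f) (hh : ContDiff ℝ ∞ h) (hu : ContDiff ℝ ∞ u)
    (hφ0 : ∀ t, φ t ≠ 0) (hf0 : ∀ t, 0 < f t)
    (θ lam : ℝ) (hθ : 0 ≤ θ)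
    (g : GRHS.BilinField ((𝓡 n).prod (𝓡 m)) (EuclideanSpace ℝ (Fin n) × F))
    (hg : g = GRHS.warpedMetric (GRHS.conformalMetric ε (φ ∘ GRHS.xi α)) (f ∘ GRHS.xi α) gF)
    (U P : EuclideanSpace ℝ (Fin n) × F → ℝ)
    (hU : U = (u ∘ GRHS.xi α) ∘ Prod.fst) (hP : P = (h ∘ GRHS.xi α) ∘ Prod.fst) :
    (2 ≤ n →
      ((GRHS.IsGRHS g U P θ lam ∧ ∃ p q, U p ≠ U q) ↔
        ((∃ s t, u s ≠ u t) ∧ ∃ μ : ℝ, GRHS.IsEinstein gF μ ∧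
          ∀ t, GRHS.SolvesSystemAt n m (GRHS.sqLength ε α) θ lam μ φ f h u t))) ∧
    (((∃ s t, u s ≠ u t) ∧ ∃ μ : ℝ, GRHS.IsEinstein gF μ ∧
        ∀ t, GRHS.SolvesSystemAt n m (GRHS.sqLength ε α) θ lam μ φ f h u t) →
      (GRHS.IsGRHS g U P θ lam ∧ ∃ p q, U p ≠ U q)) := by
  have : NeZero m := ⟨by omega⟩
  rw [← GRHS.coe_xiL] at hg hU hP
  simpa only [finrank_euclideanSpace_fin, GRHS.xiL_inverse_semiEuclidean hε] using
    theorem3_general (GRHS.isSemiRiemannian_flat_semiEuclidean hε) hgF (GRHS.xiL_ne_zero hα)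
      hφ hf hh hu hφ0 (fun t => (hf0 t).ne') hθ hg hU hP
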